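/- **Setting.** Let $s=\{s_{m,n}\}_{m,n\in\mathbb Z_+}$ be complex numbers. The *moment problem* asks for a non-negative Borel measure $\mu$ on $\mathbb R^2$ with $\int x_1^mx_2^n\,d\mu=s_{m,n}$ for all $m,n\in\mathbb Z_+$ (all integrals converging absolutely). Let $\Omega=\{(m,k,l;n,r,t): m,n\in\mathbb Z_+,\ k,l,r,t\in\mathbb Z\}$, $\Omega_0=\{(m,0,0;n,0,0)\}$, $\Omega'=\Omega\setminus\Omega_0$, and for $a=(m,k,l;n,r,t)\in\Omega$ let $y_a(x)=x_1^m(x_1+i)^k(x_1-i)^lx_2^n(x_2+i)^r(x_2-i)^t$. The *extended moment problem* with data $u=\{u_a\}_{a\in\Omega}$ asks for $\mu\ge 0$ with $\int y_a\,d\mu=u_a$ for all $a\in\Omega$ (all integrals converging absolutely). Assume the positivity condition $\sum\alpha_{m,n}\overline{\alpha_{m',n'}}\,s_{m+m',n+n'}\ge0$ for all finitely supported complex $\alpha$. Fix a model space: a Hilbert space $\mathcal H=\mathcal H_0\oplus\bigoplus_{j\ge1}\mathcal H_j$ with $\dim\mathcal H_j=1$, unit vectors $e_j\in\mathcal H_j$,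 and vectors $h_{m,n}$ with closed linear span $\mathcal H_0$ such that $(h_{m,n},h_{m',n'})=s_{m+m',n+n'}$. Fix an orthonormal basis $(g_n)_{n\in N}$ of $\mathcal H_0$ and a bijection $w:\mathbb N=\{1,2,\dots\}\to\Omega'$. There are constants $M_j$ with $\int|y_{w(j)}|^2d\mu\le M_j$ for every $j$ and every solution $\mu$ of the moment problem; fix any such $M_j$. **Linear conditions** for vectors $h_a$, where $a=(m,k,l;n,r,t)$, $b=(m',k',l';n',r',t')$: (i) $(h_{m+1,k,l;n,r,t}\pm ih_a,h_b)=(h_{a^\pm},h_b)$, where $a^+$ is $a$ with $k$ replaced by $k+1$ and $a^-$ is $a$ with $l$ replaced by $l+1$, and the analogous pair of conditions with $n,r,t$ in place of $m,k,l$; (ii) $(h_a,h_b)$ does not change when one of the pairs $(m,m'),(k,l'),(l,k'),(n,n'),(r,t'),(t,r')$ is replaced by a pair with the same sum (the entries replacing $m,m',n,n'$ being in $\mathbb Z_+$). **The set $X(\mathcal H)$** consists of the sequences $\{h_a\}_{a\in\Omega}$ in $\mathcal H$ such that 1. $h_{m,0,0;n,0,0}=h_{m,n}$; 2. for some $\Lambda\subset\mathbb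 N$ and all $r\in\mathbb N$: $h_{w(r)}\in\mathcal H_0\oplus\bigoplus_{j\in\Lambda,j\le r}\mathcal H_j$ and $(h_{w(r)},e_r)\ge0$; 3. $h_{m+1,k,l;n,r,t}+ih_a=h_{m,k+1,l;n,r,t}$ and $h_{m+1,k,l;n,r,t}-ih_a=h_{m,k,l+1;n,r,t}$, and likewise $h_{m,k,l;n+1,r,t}+ih_a=h_{m,k,l;n,r+1,t}$ and $h_{m,k,l;n+1,r,t}-ih_a=h_{m,k,l;n,r,t+1}$, for all $a=(m,k,l;n,r,t)\in\Omega$; 4. there is $\varphi:\Omega\to\mathbb C$ with $(h_a,h_b)=\varphi(m+m',k+l',l+k';n+n',r+t',t+r')$ for all $a,b\in\Omega$. The modified set $X(\mathcal H)$ is defined in the same way with $\Lambda=\{r:(h_{w(r)},e_r)>0\}$ in 2. **The algorithm.** *Step 0:* check the linear conditions which involve only the vectors $h_{m,0,0;n,0,0}:=h_{m,n}$. *Step $r\ge1$:* given $(h_{w(1)},\dots,h_{w(r-1)})\in G_{r-1}$ (no parameters if $r=1$), consider the linear conditions which contain $h_{w(r)}$ and otherwise only $h_{m,0,0;n,0,0}$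 and $h_{w(1)},\dots,h_{w(r-1)}$, written for $h_{w(r)}=\sum_n\alpha_ng_n+\sum_{j\le r}\beta_je_j$ as linear equations in $\alpha\in\ell^2$, $\beta_1,\dots,\beta_{r-1}\in\mathbb C$ and $d=\|h_{w(r)}\|^2$. Take all their solutions with $\sum|\alpha_n|^2+\sum_{j<r}|\beta_j|^2\le d\le M_r$, and let $G_r$ be the set of all tuples $(h_{w(1)},\dots,h_{w(r)})$ so obtained, with $$h_{w(r)}=\sum_n\alpha_ng_n+\sum_{j<r}\beta_je_j+\Bigl(d-\sum_n|\alpha_n|^2-\sum_{j<r}|\beta_j|^2\Bigr)^{1/2}e_r .$$ *Final step:* $\mathbf G=\bigcap_{r\ge1}\mathbf G_r$, where $\mathbf G_r$ is the set of sequences $(f_j)_{j\ge1}$ in $\mathcal H$ with $(f_1,\dots,f_r)\in G_r$ and $\|f_j\|\le\sqrt{M_j}$ for $j>r$. *Modified algorithm:* the same, except that in step $r$ one takes, for each $\vec\sigma\in\{0,1\}^{r-1}$, only those parameters in $G_{r-1}$ with $h_{w(j)}\in\mathcal H_0\oplus\bigoplus_{i<j}\mathcal H_i$ if $\sigma_j=0$,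 and $h_{w(j)}\in\mathcal H_0\oplus\bigoplus_{i\le j}\mathcal H_i$, $(h_{w(j)},e_j)>0$ if $\sigma_j=1$, uses only the $\beta_j$ with $\sigma_j=1$ ($j<r$), and lets $G_r$ be the union over $\vec\sigma$ of the sets obtained. For $\mathbf g=(f_1,f_2,\dots)\in\mathbf G$ let $\mathfrak H(\mathbf g)=\{h_a\}_{a\in\Omega}$ be the sequence with $h_{m,0,0;n,0,0}=h_{m,n}$ and $h_{w(r)}=f_r$ for $r\in\mathbb N$. **Theorem 3.3.** The moment problem has a solution if and only if the conditions of Step 0 hold and $\mathbf G\ne\emptyset$. For each $\mathbf g\in\mathbf G$ the sequence $\mathfrak H(\mathbf g)$ belongs to $X(\mathcal H)$, and the extended moment problem with moments $u_a=\varphi(a)$, $\varphi$ being the function in 4 for $\mathfrak H(\mathbf g)$, has a unique solution $\mu$; this $\mu$ is a solution of the moment problem. Every solution of the moment problem is obtained in this way from some $\mathbf g\in\mathbf G$. All of this remains true for the modified algorithm and the modified $X(\mathcal H)$, and then the correspondence $\mathbf g\mapsto\mu$ between $\mathbf G$ and the set of solutions of the moment problem is bijective. -/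

import Mathlib

open scoped ComplexOrder lp

namespace TwoDimMoment

/-! ### Moment problems in the plane -/

/-- The multi-indices `(m, k, l; n, r, t)` with `m, n ∈ ℤ₊` and `k, l, r, t ∈ ℤ` (the set `Ω`). -/
@[ext]
structure Idx where
  m : ℕ
  k : ℤ
  l : ℤ
  n : ℕ
  r : ℤ
  t : ℤ

/-- The set `Ω₀` of the indices `(m, 0, 0; n, 0, 0)`. -/
def Idx.Omega0 : Set Idx := {a | a.k = 0 ∧ a.l = 0 ∧ a.r = 0 ∧ a.t = 0}

/-- The set `Ω' = Ω \ Ω₀`. -/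
def Idx.Omega' : Set Idx := Idx.Omega0ᶜ

/-- The function `x₁ᵐ (x₁+i)ᵏ (x₁-i)ˡ x₂ⁿ (x₂+i)ʳ (x₂-i)ᵗ` on the plane. -/
noncomputable def extMonomial (a : Idx) (x : ℝ × ℝ) : ℂ :=
  (x.1 : ℂ) ^ a.m * ((x.1 : ℂ) + Complex.I) ^ a.k * ((x.1 : ℂ) - Complex.I) ^ a.l *
    ((x.2 : ℂ) ^ a.n * ((x.2 : ℂ) + Complex.I) ^ a.r * ((x.2 : ℂ) - Complex.I) ^ a.t)

/-- `μ` is a solution of the two-dimensional moment problem with moments `s`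
(in particular all the moments of `μ` exist). -/
def Solves (s : ℕ → ℕ → ℂ) (μ : MeasureTheory.Measure (ℝ × ℝ)) : Prop :=
  ∀ m n : ℕ,
    MeasureTheory.Integrable (fun x : ℝ × ℝ => (x.1 : ℂ) ^ m * (x.2 : ℂ) ^ n) μ ∧
      ∫ x : ℝ × ℝ, (x.1 : ℂ) ^ m * (x.2 : ℂ) ^ n ∂μ = s m n

/-- `μ` is a solution of the extended two-dimensional moment problem with moments `u`. -/
def SolvesExt (u : Idx → ℂ) (μ : MeasureTheory.Measure (ℝ × ℝ)) : Prop :=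
  ∀ a : Idx, MeasureTheory.Integrable (extMonomial a) μ ∧ ∫ x, extMonomial a x ∂μ = u a

/-- The positivity condition
`∑ α_{m,n} conj(α_{m',n'}) s_{m+m',n+n'} ≥ 0` for finitely supported `α`
(the order on `ℂ` makes the sum real and nonnegative). -/
def PositivityCondition (s : ℕ → ℕ → ℂ) : Prop :=
  ∀ α : (ℕ × ℕ) →₀ ℂ,
    0 ≤ ∑ p ∈ α.support, ∑ q ∈ α.support,
      α p * (starRingEnd ℂ) (α q) * s (p.1 + q.1) (p.2 + q.2)

/-- `M` bounds the numbers `∫ |x₁ᵐ (x₁+i)ᵏ ⋯ (x₂-i)ᵗ|² dμ`, `(m, k, l; n, r, t) = w j`, for all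
solutions `μ` of the moment problem with moments `s`. -/
def IsMomentBound (s : ℕ → ℕ → ℂ) (w : ℕ ≃ Idx.Omega') (M : ℕ → ℝ) : Prop :=
  ∀ μ : MeasureTheory.Measure (ℝ × ℝ), Solves s μ →
    ∀ j : ℕ, ∫ x, ‖extMonomial (w j) x‖ ^ 2 ∂μ ≤ M j

/-! ### Model spaces -/

section Spaces

variable {𝓗 : Type*} [NormedAddCommGroup 𝓗] [InnerProductSpace ℂ 𝓗]

/-- The scalar product, linear in the first and antilinear in the second variable. -/
noncomputable def ip (x y : 𝓗) : ℂ := inner ℂ y x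

/-- A realization of the Hilbert space `𝓗` as a model space
`𝓗 = 𝓗₀ ⊕ (⨁_j 𝓗_j)` for the moments `s`: `h` is a sequence in `𝓗₀` with
`(h_{m,n}, h_{m',n'}) = s_{m+m',n+n'}` whose closed linear span is `𝓗₀`, and `e j` is a unit vector
of the one-dimensional space `𝓗_j`. Indices `j` start from `0`. -/
structure ModelSpace (s : ℕ → ℕ → ℂ) (𝓗 : Type*) [NormedAddCommGroup 𝓗]
    [InnerProductSpace ℂ 𝓗] where
  H0 : Submodule ℂ 𝓗
  h : ℕ → ℕ → 𝓗
  e : ℕ → 𝓗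
  gram : ∀ m n m' n', ip (h m n) (h m' n') = s (m + m') (n + n')
  span_h : (Submodule.span ℂ (Set.range fun p : ℕ × ℕ => h p.1 p.2)).topologicalClosure = H0
  orthonormal_e : Orthonormal ℂ e
  orthogonal : ∀ x ∈ H0, ∀ j, ip x (e j) = 0
  total : (H0 ⊔ Submodule.span ℂ (Set.range e)).topologicalClosure = ⊤

/-- The subspace `𝓗₀ ⊕ (⨁_{j ∈ J} 𝓗_j)` (used for finite `J`, when it is closed). -/
def ModelSpace.partialSum {s : ℕ → ℕ → ℂ} (S : ModelSpace s 𝓗) (J : Set ℕ) : Submodule ℂ 𝓗 :=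
  S.H0 ⊔ Submodule.span ℂ (S.e '' J)

/-! ### The linear conditions and the sets `X(𝓗)` -/

/-- Those of the linear conditions whose set `T` of occurring indices satisfies `adm T`, written
for a function `B` in the role of `B a b = (h_a, h_b)`. The first four say
`(h_{m+1,…} ± i h_{m,…}, h_b) = (h_{…,k+1,…} resp. h_{…,l+1,…}, h_b)` and the same for the second
variable; the last six say that `(h_a, h_b)` is unchanged when a pair of coordinates that occurs
in `(m + m', k + l', l + k'; n + n', r + t', t + r')` is changed with its sum kept. -/
def LinearConditions (adm : Set Idx → Prop) (B : Idx → Idx → ℂ) : Prop :=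
  (∀ a b : Idx, adm {{a with m := a.m + 1}, a, {a with k := a.k + 1}, b} →
    B {a with m := a.m + 1} b + Complex.I * B a b = B {a with k := a.k + 1} b) ∧
  (∀ a b : Idx, adm {{a with m := a.m + 1}, a, {a with l := a.l + 1}, b} →
    B {a with m := a.m + 1} b - Complex.I * B a b = B {a with l := a.l + 1} b) ∧
  (∀ a b : Idx, adm {{a with n := a.n + 1}, a, {a with r := a.r + 1}, b} →
    B {a with n := a.n + 1} b + Complex.I * B a b = B {a with r := a.r + 1} b) ∧
  (∀ a b : Idx, adm {{a with n := a.n + 1}, a, {a with t := a.t + 1}, b} →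
    B {a with n := a.n + 1} b - Complex.I * B a b = B {a with t := a.t + 1} b) ∧
  (∀ (a b : Idx) (p q : ℕ), a.m + b.m = p + q →
    adm {a, b, {a with m := p}, {b with m := q}} → B a b = B {a with m := p} {b with m := q}) ∧
  (∀ (a b : Idx) (p q : ℤ), a.k + b.l = p + q →
    adm {a, b, {a with k := p}, {b with l := q}} → B a b = B {a with k := p} {b with l := q}) ∧
  (∀ (a b : Idx) (p q : ℤ), a.l + b.k = p + q →
    adm {a, b, {a with l := p}, {b with k := q}} → B a b = B {a with l := p} {b with k := q}) ∧
  (∀ (a b : Idx) (p q : ℕ), a.n + b.n = p + q →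
    adm {a, b, {a with n := p}, {b with n := q}} → B a b = B {a with n := p} {b with n := q}) ∧
  (∀ (a b : Idx) (p q : ℤ), a.r + b.t = p + q →
    adm {a, b, {a with r := p}, {b with t := q}} → B a b = B {a with r := p} {b with t := q}) ∧
  (∀ (a b : Idx) (p q : ℤ), a.t + b.r = p + q →
    adm {a, b, {a with t := p}, {b with r := q}} → B a b = B {a with t := p} {b with r := q})

/-- The vector relations
`H_{m+1,…} ± i H_{m,…} = H_{…,k+1,…}` (resp. `H_{…,l+1,…}`), and the same in the second variable. -/
def ShiftRelations (H : Idx → 𝓗) : Prop :=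
  ∀ a : Idx,
    H {a with m := a.m + 1} + Complex.I • H a = H {a with k := a.k + 1} ∧
    H {a with m := a.m + 1} - Complex.I • H a = H {a with l := a.l + 1} ∧
    H {a with n := a.n + 1} + Complex.I • H a = H {a with r := a.r + 1} ∧
    H {a with n := a.n + 1} - Complex.I • H a = H {a with t := a.t + 1}

/-- `(H_a, H_b) = φ(m + m', k + l', l + k'; n + n', r + t', t + r')` for all indices
`a = (m, k, l; n, r, t)` and `b = (m', k', l'; n', r', t')`. -/
def HasGramFunction (H : Idx → 𝓗) (φ : Idx → ℂ) : Prop :=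
  ∀ a b : Idx, ip (H a) (H b) =
    φ ⟨a.m + b.m, a.k + b.l, a.l + b.k, a.n + b.n, a.r + b.t, a.t + b.r⟩

/-- `μ` solves the extended moment problem whose moments are given by the function `φ`
of the sequence `H`. -/
def Generates (H : Idx → 𝓗) (μ : MeasureTheory.Measure (ℝ × ℝ)) : Prop :=
  ∃ φ : Idx → ℂ, HasGramFunction H φ ∧ SolvesExt φ μ

variable {s : ℕ → ℕ → ℂ} (S : ModelSpace s 𝓗) (w : ℕ ≃ Idx.Omega')

/-- The set `X(𝓗)`. -/
def setX : Set (Idx → 𝓗) :=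
  {H | (∀ m n, H ⟨m, 0, 0, n, 0, 0⟩ = S.h m n) ∧
    (∃ Λ : Set ℕ, ∀ r : ℕ,
      H (w r) ∈ S.partialSum {j | j ∈ Λ ∧ j ≤ r} ∧ 0 ≤ ip (H (w r)) (S.e r)) ∧
    ShiftRelations H ∧ ∃ φ, HasGramFunction H φ}

/-- The modified set `X(𝓗)`, in which `Λ = {r : (H_{w(r)}, e_r) > 0}`. -/
def setXmod : Set (Idx → 𝓗) :=
  {H | (∀ m n, H ⟨m, 0, 0, n, 0, 0⟩ = S.h m n) ∧
    (∀ r : ℕ,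
      H (w r) ∈ S.partialSum {j | 0 < ip (H (w j)) (S.e j) ∧ j ≤ r} ∧
        0 ≤ ip (H (w r)) (S.e r)) ∧
    ShiftRelations H ∧ ∃ φ, HasGramFunction H φ}

open Classical in
/-- The sequence `{H_a}_{a ∈ Ω}` with `H_{m,0,0;n,0,0} = h_{m,n}` and `H_{w(r)} = g_r`. -/
noncomputable def assemble (g : ℕ → 𝓗) : Idx → 𝓗 := fun a =>
  if ha : a ∈ Idx.Omega' then g (w.symm ⟨a, ha⟩) else S.h a.m a.n

/-! ### The algorithm

Steps are counted from `0`: a tuple in `Fin r → 𝓗` consists of the vectors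
`h_{w(0)}, …, h_{w(r-1)}` found in the previous steps, and the step looks for `h_{w(r)}`. -/

/-- The condition checked at the outset: the linear conditions
which involve only the vectors `h_{m,0,0;n,0,0} = h_{m,n}`. -/
def InitialCheck : Prop :=
  LinearConditions (fun T => T ⊆ Idx.Omega0) (fun a b => ip (S.h a.m a.n) (S.h b.m b.n))

/-- The sequence of all vectors known before step `r`; the indices
not yet treated get the dummy value `0`. -/
noncomputable def knownVectors (r : ℕ) (prev : Fin r → 𝓗) : Idx → 𝓗 :=
  assemble S w (fun j => if hj : j < r then prev ⟨j, hj⟩ else 0)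

/-- Parameters and unknowns of step `r`: the vectors `prev` found before, the coefficients `α`
(with respect to an orthonormal basis of `𝓗₀`), the coefficients `β j` for `j ∈ A`,
and the number `d = ‖h_{w(r)}‖²`. -/
structure Candidate (𝓗 : Type*) (ι : Type*) (r : ℕ) (A : Finset (Fin r)) where
  prev : Fin r → 𝓗
  α : ℓ²(ι, ℂ)
  β : A → ℂ
  d : ℝ

variable {ι : Type*} (g : HilbertBasis ι ℂ S.H0) (M : ℕ → ℝ)

/-- `∑_n α_n g_n + ∑_{j ∈ A} β_j e_j`. -/
noncomputable def lowerPart {r : ℕ} {A : Finset (Fin r)} (c : Candidate 𝓗 ι r A) : 𝓗 :=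
  ∑' n, c.α n • (g n : 𝓗) + ∑ j : A, c.β j • S.e (j : Fin r)

/-- `∑_n |α_n|² + ∑_{j ∈ A} |β_j|²`. -/
noncomputable def lowerNormSq {r : ℕ} {A : Finset (Fin r)} (c : Candidate 𝓗 ι r A) : ℝ :=
  ∑' n, ‖c.α n‖ ^ 2 + ∑ j : A, ‖c.β j‖ ^ 2

open Classical in
/-- The scalar products `(h_a, h_b)` among the known vectors and the unknown `h_{w(r)}`, expressed
linearly through the unknowns: the products of `h_{w(r)}` with the known vectors (which are
orthogonal to `e_r`) depend on `α` and `β` only, and `(h_{w(r)}, h_{w(r)}) = d`. -/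
noncomputable def stepGram {r : ℕ} {A : Finset (Fin r)} (c : Candidate 𝓗 ι r A) (a b : Idx) : ℂ :=
  if a = w r then
    if b = w r then (c.d : ℂ) else ip (lowerPart S g c) (knownVectors S w r c.prev b)
  else
    if b = w r then ip (knownVectors S w r c.prev a) (lowerPart S g c)
    else ip (knownVectors S w r c.prev a) (knownVectors S w r c.prev b)

/-- The solutions, with parameters in `Γ`, of the system of step `r`: all the linear conditions
which contain `h_{w(r)}` and otherwise only vectors that are already known. -/
def stepSolutions (r : ℕ) (Γ : Set (Fin r → 𝓗)) (A : Finset (Fin r)) :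
    Set (Candidate 𝓗 ι r A) :=
  {c | c.prev ∈ Γ ∧
    LinearConditions
      (fun T => (w r : Idx) ∈ T ∧ T ⊆ Idx.Omega0 ∪ {a | ∃ j ≤ r, a = w j})
      (stepGram S w g c)}

/-- The solutions with `∑ |α_n|² + ∑ |β_j|² ≤ d ≤ M_r`. -/
def admissibleSolutions (r : ℕ) (Γ : Set (Fin r → 𝓗)) (A : Finset (Fin r)) :
    Set (Candidate 𝓗 ι r A) :=
  {c | c ∈ stepSolutions S w g r Γ A ∧ lowerNormSq c ≤ c.d ∧ c.d ≤ M r}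

/-- `h_{w(r)} = ∑_n α_n g_n + ∑_{j ∈ A} β_j e_j + (d - ∑_n |α_n|² - ∑_{j ∈ A} |β_j|²)^{1/2} e_r`. -/
noncomputable def newVector {r : ℕ} {A : Finset (Fin r)} (c : Candidate 𝓗 ι r A) : 𝓗 :=
  lowerPart S g c + ((√(c.d - lowerNormSq c) : ℝ) : ℂ) • S.e r

/-- The tuples `(h_{w(0)}, …, h_{w(r)})` produced by one step. -/
noncomputable def stepTuples (r : ℕ) (Γ : Set (Fin r → 𝓗)) (A : Finset (Fin r)) :
    Set (Fin (r + 1) → 𝓗) :=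
  (fun c : Candidate 𝓗 ι r A => Fin.snoc (α := fun _ => 𝓗) c.prev (newVector S g c)) ''
    admissibleSolutions S w g M r Γ A

/-- The set `G_r` of tuples of length `r` of the original algorithm. -/
noncomputable def tuplesG : (r : ℕ) → Set (Fin r → 𝓗)
  | 0 => Set.univ
  | r + 1 => stepTuples S w g M r (tuplesG r) Finset.univ

/-- The tuples `(h_j)_{j < r}` with `h_j ∈ 𝓗₀ ⊕ (⨁_{i < j} 𝓗_i)` if `σ j = 0`, and
`h_j ∈ 𝓗₀ ⊕ (⨁_{i ≤ j} 𝓗_i)`, `(h_j, e_j) > 0` if `σ j = 1`. -/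
def patternTuples (r : ℕ) (σ : Fin r → Bool) : Set (Fin r → 𝓗) :=
  {p | ∀ j : Fin r,
    (σ j = false → p j ∈ S.partialSum {i | i < (j : ℕ)}) ∧
    (σ j = true → p j ∈ S.partialSum {i | i ≤ (j : ℕ)} ∧ 0 < ip (p j) (S.e j))}

/-- The set `G_r` of tuples of length `r` of the modified algorithm: for each binary pattern `σ`
the step is carried out with parameters of that pattern and with `β_j`, `σ j = 1`, only. -/
noncomputable def tuplesGmod : (r : ℕ) → Set (Fin r → 𝓗)
  | 0 => Set.univ
  | r + 1 => ⋃ σ : Fin r → Bool,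
      stepTuples S w g M r (tuplesGmod r ∩ patternTuples S r σ)
        (Finset.univ.filter fun j => σ j = true)

/-- The final step: the sequences `(h_0, …, h_{r-1}, g_r, g_{r+1}, …)` with
`(h_0, …, h_{r-1}) ∈ G_r` and `‖g_j‖ ≤ √M_j`, intersected over `r = 1, 2, …`. -/
def finalSet (G : (r : ℕ) → Set (Fin r → 𝓗)) : Set (ℕ → 𝓗) :=
  ⋂ r : ℕ, {f | (fun j : Fin (r + 1) => f j) ∈ G (r + 1) ∧ ∀ j, r + 1 ≤ j → ‖f j‖ ≤ √(M j)}

/-- The set `𝐆` of the algorithm. -/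
noncomputable def setG : Set (ℕ → 𝓗) := finalSet M (tuplesG S w g M)

/-- The set `𝐆` of the modified algorithm. -/
noncomputable def setGmod : Set (ℕ → 𝓗) := finalSet M (tuplesGmod S w g M)

end Spaces

end TwoDimMoment

/-!
The proof passes between three descriptions of a solution `μ` of the moment problem.

*From sequences of vectors to measures.* A sequence produced by the algorithm satisfies every
linear condition, since a linear condition involves finitely many vectors and is imposed in the
step that finds the last of them (`linearConditions_of_isStepOutput`). Hence the vectors satisfy
the shift relations and have a Gram function `φ`. For the extended moment problem with the moments
`φ` the functions `z₁^{j₁} z₂^{j₂}`, where `z = (x - i) / (x + i)` is the Cayley transform, belong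
to the test functions. The numbers that `φ` assigns to
`z₁^{j₁} z₂^{j₂} (1 + x₁²)^{N₁} (1 + x₂²)^{N₂}` are positive definite in `j`, so by Herglotz'
theorem (`IsPosDefSeq.exists_measure`) they are the Fourier coefficients of a measure `ν_{N₁,N₂}`
on the torus. As `(1 + x²)⁻¹ = |1 - z|² / 4` is a trigonometric polynomial, the shift relations for
`φ` say that `ν_{0,0}` has the density `((1 + x₁²)^{N₁} (1 + x₂²)^{N₂})⁻¹` with respect to
`ν_{N₁,N₂}` (`withDensity_torusWeight`). Therefore `ν_{0,0}` does not charge the points at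
infinity, and carried over to the plane it has the moments `φ` (`exists_solvesExt`). Uniqueness of
Fourier coefficients on the torus gives uniqueness of the measure (`SolvesExt.unique`).

*From measures to sequences of vectors.* All functions `y_a` belong to `L²(μ)`, and the map
`x₁ᵐ x₂ⁿ ↦ h_{m,n}` extends to an isometry of the closed span of the polynomials onto `𝓗₀`.
Gram-Schmidt orthogonalization of the components of `y_{w(r)}` orthogonal to the polynomials
continues this isometry to all `y_a`, sending the `r`-th Gram-Schmidt vector to `e r`
(`exists_triangular_copy`). The images of the `y_{w(r)}` can be found by both algorithms
(`isStepOutput_of_triangular`).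

*Uniqueness.* In the modified algorithm the vector `e j` is available only if the `j`-th vector has
a positive coefficient at `e j`, that is, only if the Gram-Schmidt process does not degenerate
there. A sequence of this form can be recovered from its Gram matrix (`eq_of_gram_eq`), and the
Gram matrix consists of integrals with respect to `μ`.
-/

namespace TwoDimMoment

open MeasureTheory

/-! ### Positive definite functions on `ℤᵈ` and measures on the torus -/

section Torus

open UnitAddTorus Filter Topology

variable {d : Type*} [Fintype d]

/-- The normalized Haar measure of the torus. -/
noncomputable def torusHaar (d : Type*) [Fintype d] : Measure (UnitAddTorus d) :=
  Measure.pi fun _ => AddCircle.haarAddCircle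

instance : IsProbabilityMeasure (torusHaar d) := by
  unfold torusHaar; infer_instance

lemma integral_fourier_haar (n : ℤ) :
    ∫ x : UnitAddCircle, fourier n x ∂AddCircle.haarAddCircle = if n = 0 then 1 else 0 := by
  split_ifs with h
  · subst h; simp
  · exact integral_eq_zero_of_add_right_eq_neg (μ := AddCircle.haarAddCircle)
      (fourier_add_half_inv_index h (by norm_num))

lemma integral_mFourier_torusHaar (n : d → ℤ) :
    ∫ x, mFourier n x ∂(torusHaar d) = if n = 0 then 1 else 0 := by
  have h : ∫ x, mFourier n x ∂(torusHaar d) =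
      ∏ i, ∫ x : UnitAddCircle, fourier (n i) x ∂AddCircle.haarAddCircle :=
    integral_fintype_prod_eq_prod (𝕜 := ℂ) (fun i (x : UnitAddCircle) => fourier (n i) x)
  rw [h]
  simp_rw [integral_fourier_haar]
  split_ifs with hn
  · simp [hn]
  · obtain ⟨i, hi⟩ := Function.ne_iff.1 hn
    exact Finset.prod_eq_zero (Finset.mem_univ i) (if_neg hi)

/-- Positive definiteness of a function on `ℤᵈ`. -/
def IsPosDefSeq (c : (d → ℤ) → ℂ) : Prop :=
  ∀ (s : Finset (d → ℤ)) (α : (d → ℤ) → ℂ),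
    0 ≤ ∑ j ∈ s, ∑ k ∈ s, α j * (starRingEnd ℂ) (α k) * c (j - k)

/-- The trigonometric polynomial `∑_{j, k ∈ s} c_{j-k} e_{k-j}`, which for a box `s` is a multiple
of the Fejér mean of the formal Fourier series `∑ c_j e_{-j}`. -/
noncomputable def fejerSum (c : (d → ℤ) → ℂ) (s : Finset (d → ℤ)) (x : UnitAddTorus d) : ℂ :=
  ∑ j ∈ s, ∑ k ∈ s, c (j - k) * mFourier (k - j) x

lemma continuous_fejerSum (c : (d → ℤ) → ℂ) (s : Finset (d → ℤ)) :
    Continuous (fejerSum c s) := by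
  unfold fejerSum
  fun_prop

lemma IsPosDefSeq.fejerSum_nonneg {c : (d → ℤ) → ℂ} (hc : IsPosDefSeq c)
    (s : Finset (d → ℤ)) (x : UnitAddTorus d) : 0 ≤ fejerSum c s x := by
  have h := hc s fun j => mFourier (-j) x
  unfold fejerSum
  convert h using 3 with j _ k _
  rw [← mFourier_neg, neg_neg, ← mFourier_add, mul_comm, neg_add_eq_sub]

lemma integral_fejerSum_mul_mFourier [DecidableEq d] (c : (d → ℤ) → ℂ) (s : Finset (d → ℤ))
    (m : d → ℤ) :
    ∫ x, fejerSum c s x * mFourier m x ∂(torusHaar d) =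
      ((s.filter fun j => j - m ∈ s).card : ℂ) * c m := by
  have hint : ∀ (j k : d → ℤ),
      Integrable (fun x => c (j - k) * mFourier (k - j + m) x) (torusHaar d) := fun j k =>
    Continuous.integrable_of_hasCompactSupport (by fun_prop) (HasCompactSupport.of_compactSpace _)
  have h1 : ∀ x, fejerSum c s x * mFourier m x =
      ∑ j ∈ s, ∑ k ∈ s, c (j - k) * mFourier (k - j + m) x := by
    intro x
    simp only [fejerSum, Finset.sum_mul, mFourier_add, mul_assoc]
  simp_rw [h1]
  rw [integral_finsetSum _ fun j _ => integrable_finsetSum _ fun k _ => hint j k]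
  simp_rw [integral_finsetSum s fun k _ => hint _ k, integral_const_mul,
    integral_mFourier_torusHaar]
  have h2 : ∀ j k : d → ℤ, k - j + m = 0 ↔ k = j - m := fun j k => by
    rw [← sub_eq_zero (a := k)]; constructor <;> intro h <;> rw [← h] <;> abel
  simp only [h2, mul_ite, mul_one, mul_zero, Finset.sum_ite_eq']
  rw [← Finset.sum_filter, Finset.sum_congr rfl (g := fun _ => c m), Finset.sum_const,
    nsmul_eq_mul]
  intro j _
  simp

/-- The measure with the density `fejerSum c s / |s|`. -/
noncomputable def fejerMeasure (c : (d → ℤ) → ℂ) (s : Finset (d → ℤ)) :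
    Measure (UnitAddTorus d) :=
  (torusHaar d).withDensity fun x => ENNReal.ofReal ((fejerSum c s x).re / s.card)

lemma measurable_fejerSum_re (c : (d → ℤ) → ℂ) (s : Finset (d → ℤ)) :
    Measurable fun x => (fejerSum c s x).re / (s.card : ℝ) :=
  (by have := continuous_fejerSum c s; fun_prop :
    Continuous fun x => (fejerSum c s x).re / (s.card : ℝ)).measurable

instance (c : (d → ℤ) → ℂ) (s : Finset (d → ℤ)) : IsFiniteMeasure (fejerMeasure c s) := by
  refine isFiniteMeasure_withDensity_ofReal (Integrable.hasFiniteIntegral ?_)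
  have := continuous_fejerSum c s
  exact Continuous.integrable_of_hasCompactSupport (by fun_prop)
    (HasCompactSupport.of_compactSpace _)

lemma IsPosDefSeq.integral_mFourier_fejerMeasure [DecidableEq d] {c : (d → ℤ) → ℂ}
    (hc : IsPosDefSeq c) (s : Finset (d → ℤ)) (m : d → ℤ) :
    ∫ x, mFourier m x ∂(fejerMeasure c s) =
      ((s.filter fun j => j - m ∈ s).card / s.card : ℝ) * c m := by
  unfold fejerMeasure
  rw [integral_withDensity_eq_integral_toReal_smul
    (measurable_fejerSum_re c s).ennreal_ofReal (by simp)]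
  have h : ∀ x, (ENNReal.ofReal ((fejerSum c s x).re / s.card)).toReal • mFourier m x =
      (s.card : ℂ)⁻¹ * (fejerSum c s x * mFourier m x) := by
    intro x
    have h0 := hc.fejerSum_nonneg s x
    have h1 : ((fejerSum c s x).re : ℂ) = fejerSum c s x := by
      rw [Complex.le_def] at h0
      exact Complex.ext rfl (by simpa using h0.2)
    rw [ENNReal.toReal_ofReal (div_nonneg (Complex.le_def.1 h0).1 (Nat.cast_nonneg _)),
      Complex.real_smul]
    push_cast
    rw [h1]
    ring
  simp_rw [h]
  rw [integral_const_mul, integral_fejerSum_mul_mFourier]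
  push_cast
  ring

/-- The boxes `{0, …, N}ᵈ` are asymptotically invariant under translations. -/
lemma tendsto_box_overlap [DecidableEq d] (m : d → ℤ) :
    Tendsto (fun N : ℕ =>
      ((((Fintype.piFinset fun _ : d => Finset.Ico (0 : ℤ) (N + 1)).filter fun j =>
        j - m ∈ Fintype.piFinset fun _ : d => Finset.Ico (0 : ℤ) (N + 1)).card : ℝ) /
        (Fintype.piFinset fun _ : d => Finset.Ico (0 : ℤ) (N + 1)).card)) atTop (𝓝 1) := by
  have h1 : ∀ N : ℕ, ((Fintype.piFinset fun _ : d => Finset.Ico (0 : ℤ) (N + 1)).filter fun j =>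
        j - m ∈ Fintype.piFinset fun _ : d => Finset.Ico (0 : ℤ) (N + 1)) =
      Fintype.piFinset fun i : d => Finset.Ico (max 0 (m i)) (min (N + 1) (N + 1 + m i)) := by
    intro N
    ext j
    simp only [Finset.mem_filter, Fintype.mem_piFinset, Finset.mem_Ico, Pi.sub_apply, max_le_iff,
      lt_min_iff, ← forall_and]
    refine forall_congr' fun i => ?_
    constructor <;> intro h <;> omega
  simp_rw [h1, Fintype.card_piFinset, Int.card_Ico]
  push_cast
  simp_rw [← Finset.prod_div_distrib]
  have h2 : ∀ i ∈ (Finset.univ : Finset d), Tendsto (fun N : ℕ =>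
      (((min (N + 1 : ℤ) (N + 1 + m i) - max 0 (m i)).toNat : ℝ) / (((N : ℤ) + 1 - 0).toNat : ℝ)))
      atTop (𝓝 1) := by
    intro i _
    have h3 : Tendsto (fun N : ℕ => 1 - (|m i| : ℝ) * (1 / ((N : ℝ) + 1))) atTop (𝓝 1) := by
      simpa using (tendsto_one_div_add_atTop_nhds_zero_nat.const_mul (|m i| : ℝ)).const_sub 1
    refine h3.congr' ?_
    filter_upwards [eventually_ge_atTop (m i).natAbs] with N hN
    have h4 : ((N : ℤ) + 1 - 0).toNat = N + 1 := by omega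
    have h5 : (((min (N + 1 : ℤ) (N + 1 + m i) - max 0 (m i)).toNat : ℤ)) = N + 1 - |m i| := by
      rcases abs_cases (m i) with h | h <;> omega
    have h6 : (((min (N + 1 : ℤ) (N + 1 + m i) - max 0 (m i)).toNat : ℝ)) = N + 1 - |(m i : ℝ)| := by
      exact_mod_cast h5
    rw [h4, h6]
    push_cast
    field_simp
  simpa using tendsto_finsetProd _ h2

/-- **Herglotz' theorem** on the torus: a positive definite function on `ℤᵈ` is the sequence of
the Fourier coefficients of a finite measure, obtained as a weak limit of Fejér means. -/
theorem IsPosDefSeq.exists_measure {c : (d → ℤ) → ℂ} (hc : IsPosDefSeq c) :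
    ∃ ν : Measure (UnitAddTorus d), IsFiniteMeasure ν ∧ ∀ j, ∫ x, mFourier j x ∂ν = c j := by
  classical
  set box : ℕ → Finset (d → ℤ) := fun N => Fintype.piFinset fun _ => Finset.Ico (0 : ℤ) (N + 1)
  have hbox : ∀ N, ((box N).card : ℝ) ≠ 0 := by
    intro N
    have : 0 < (box N).card := Finset.card_pos.2 ⟨0, by simp [box]⟩
    positivity
  let μs : ℕ → FiniteMeasure (UnitAddTorus d) := fun N => ⟨fejerMeasure c (box N), inferInstance⟩
  have hint : ∀ N m, ∫ x, mFourier m x ∂(μs N : Measure (UnitAddTorus d)) =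
      (((box N).filter fun j => j - m ∈ box N).card / (box N).card : ℝ) * c m := fun N m =>
    hc.integral_mFourier_fejerMeasure (box N) m
  -- the total masses of the Fejér means are `c 0`, so these measures lie in a weakly compact set
  have hmass : ∀ N, μs N ∈ {μ : FiniteMeasure (UnitAddTorus d) | μ.mass ≤ (c 0).re.toNNReal} := by
    intro N
    have h := hint N 0
    simp only [mFourier_zero, ContinuousMap.one_apply, sub_zero, Finset.filter_mem_eq_inter,
      Finset.inter_self, div_self (hbox N), Complex.ofReal_one, one_mul, integral_const,
      Complex.real_smul, mul_one] at h
    have h2 : (μs N).mass = (c 0).re.toNNReal := by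
      rw [← h, Complex.ofReal_re, measureReal_def]
      exact (Real.toNNReal_coe).symm
    exact h2.le
  obtain ⟨ν, -, hν⟩ := (isCompact_setOfPred_finiteMeasure_le_of_compactSpace (UnitAddTorus d)
    (c 0).re.toNNReal).ultrafilter_le_nhds ((hyperfilter ℕ).map μs)
    (by
      rw [le_principal_iff]
      exact Filter.mem_map.2 (Filter.univ_mem' hmass))
  have hlim : Tendsto μs (hyperfilter ℕ) (𝓝 ν) := hν
  refine ⟨ν, inferInstance, fun j => ?_⟩
  have h1 := (FiniteMeasure.tendsto_iff_forall_integral_rclike_tendsto ℂ).1 hlim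
    (BoundedContinuousFunction.mkOfCompact (mFourier j))
  simp only [BoundedContinuousFunction.mkOfCompact_apply, hint] at h1
  have h2 : Tendsto (fun N => ((((box N).filter fun k => k - j ∈ box N).card / (box N).card : ℝ)
      : ℂ) * c j) atTop (𝓝 (c j)) := by
    have := ((Complex.continuous_ofReal.tendsto 1).comp (tendsto_box_overlap j)).mul_const (c j)
    rwa [Complex.ofReal_one, one_mul] at this
  exact tendsto_nhds_unique h1 (h2.mono_left Nat.hyperfilter_le_atTop)

/-- A finite measure on the torus is determined by its Fourier coefficients. -/
theorem measure_ext_of_mFourier {μ ν : Measure (UnitAddTorus d)} [IsFiniteMeasure μ]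
    [IsFiniteMeasure ν] (h : ∀ j, ∫ x, mFourier j x ∂μ = ∫ x, mFourier j x ∂ν) : μ = ν := by
  have hint : ∀ (ρ : Measure (UnitAddTorus d)) [IsFiniteMeasure ρ] (f : C(UnitAddTorus d, ℂ)),
      Integrable f ρ := fun ρ _ f =>
    Continuous.integrable_of_hasCompactSupport f.continuous (HasCompactSupport.of_compactSpace _)
  have hcont : ∀ (ρ : Measure (UnitAddTorus d)) [IsFiniteMeasure ρ],
      Continuous fun f : C(UnitAddTorus d, ℂ) => ∫ x, f x ∂ρ := by
    intro ρ _
    let Λ : C(UnitAddTorus d, ℂ) →ₗ[ℂ] ℂ :=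
      { toFun := fun f => ∫ x, f x ∂ρ
        map_add' := fun f g => integral_add (hint ρ f) (hint ρ g)
        map_smul' := fun a f => integral_smul a f }
    exact (Λ.mkContinuous (ρ.real Set.univ) fun f => (norm_integral_le_of_norm_le_const
      (.of_forall fun x => f.norm_coe_le_norm x)).trans (mul_comm _ _).le).continuous
  have key : ∀ f : C(UnitAddTorus d, ℂ), ∫ x, f x ∂μ = ∫ x, f x ∂ν := by
    intro f
    have hf : f ∈ (Submodule.span ℂ (Set.range (mFourier (d := d)))).topologicalClosure := by
      rw [span_mFourier_closure_eq_top]; trivial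
    refine closure_minimal (t := {f : C(UnitAddTorus d, ℂ) | ∫ x, f x ∂μ = ∫ x, f x ∂ν}) ?_
      (isClosed_eq (hcont μ) (hcont ν)) hf
    intro g hg
    refine Submodule.span_induction ?_ ?_ ?_ ?_ hg
    · rintro _ ⟨j, rfl⟩; exact h j
    · simp
    · intro u v _ _ hu hv
      simp only [Set.mem_ofPred_eq, ContinuousMap.add_apply] at *
      rw [integral_add (hint μ u) (hint μ v), integral_add (hint ν u) (hint ν v), hu, hv]
    · intro a u _ hu
      simp only [Set.mem_ofPred_eq, ContinuousMap.smul_apply, integral_smul] at *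
      rw [hu]
  refine ext_of_forall_integral_eq_of_IsFiniteMeasure fun f => ?_
  have := key ⟨fun x => (f x : ℂ), by fun_prop⟩
  simp only [ContinuousMap.coe_mk] at this
  rw [integral_complex_ofReal, integral_complex_ofReal] at this
  exact_mod_cast this

end Torus

/-! ### Extended monomials and the Cayley transform -/

section Monomials

lemma ofReal_add_I_ne_zero (x : ℝ) : (x : ℂ) + Complex.I ≠ 0 := fun h => by
  simpa using congrArg Complex.im h

lemma ofReal_sub_I_ne_zero (x : ℝ) : (x : ℂ) - Complex.I ≠ 0 := fun h => by
  simpa using congrArg Complex.im h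

lemma continuous_extMonomial (a : Idx) : Continuous (extMonomial a) := by
  unfold extMonomial
  have h1 : ∀ x : ℝ × ℝ, (x.1 : ℂ) + Complex.I ≠ 0 := fun x => ofReal_add_I_ne_zero _
  have h2 : ∀ x : ℝ × ℝ, (x.1 : ℂ) - Complex.I ≠ 0 := fun x => ofReal_sub_I_ne_zero _
  have h3 : ∀ x : ℝ × ℝ, (x.2 : ℂ) + Complex.I ≠ 0 := fun x => ofReal_add_I_ne_zero _
  have h4 : ∀ x : ℝ × ℝ, (x.2 : ℂ) - Complex.I ≠ 0 := fun x => ofReal_sub_I_ne_zero _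
  exact (((by fun_prop : Continuous fun x : ℝ × ℝ => (x.1 : ℂ) ^ a.m).mul
    (Continuous.zpow₀ (by fun_prop) _ fun x => .inl (h1 x))).mul
    (Continuous.zpow₀ (by fun_prop) _ fun x => .inl (h2 x))).mul
    (((by fun_prop : Continuous fun x : ℝ × ℝ => (x.2 : ℂ) ^ a.n).mul
    (Continuous.zpow₀ (by fun_prop) _ fun x => .inl (h3 x))).mul
    (Continuous.zpow₀ (by fun_prop) _ fun x => .inl (h4 x)))

lemma extMonomial_omega0 (m n : ℕ) (x : ℝ × ℝ) :
    extMonomial ⟨m, 0, 0, n, 0, 0⟩ x = (x.1 : ℂ) ^ m * (x.2 : ℂ) ^ n := by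
  simp [extMonomial]

/-- The index whose function is the product of the function of `a` and the complex conjugate of
the function of `b`. -/
def Idx.mulConj (a b : Idx) : Idx :=
  ⟨a.m + b.m, a.k + b.l, a.l + b.k, a.n + b.n, a.r + b.t, a.t + b.r⟩

lemma extMonomial_mulConj (a b : Idx) (x : ℝ × ℝ) :
    extMonomial (a.mulConj b) x = extMonomial a x * (starRingEnd ℂ) (extMonomial b x) := by
  simp only [extMonomial, Idx.mulConj, map_mul, map_pow, map_zpow₀, map_add, map_sub,
    Complex.conj_ofReal, Complex.conj_I, sub_neg_eq_add, ← sub_eq_add_neg, pow_add,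
    zpow_add₀ (ofReal_add_I_ne_zero _), zpow_add₀ (ofReal_sub_I_ne_zero _)]
  ring

lemma extMonomial_shift (a : Idx) (x : ℝ × ℝ) :
    extMonomial {a with m := a.m + 1} x + Complex.I * extMonomial a x =
      extMonomial {a with k := a.k + 1} x ∧
    extMonomial {a with m := a.m + 1} x - Complex.I * extMonomial a x =
      extMonomial {a with l := a.l + 1} x ∧
    extMonomial {a with n := a.n + 1} x + Complex.I * extMonomial a x =
      extMonomial {a with r := a.r + 1} x ∧
    extMonomial {a with n := a.n + 1} x - Complex.I * extMonomial a x =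
      extMonomial {a with t := a.t + 1} x := by
  simp only [extMonomial, pow_succ, zpow_add_one₀ (ofReal_add_I_ne_zero _),
    zpow_add_one₀ (ofReal_sub_I_ne_zero _)]
  refine ⟨?_, ?_, ?_, ?_⟩ <;> ring

end Monomials

section Cayley

open UnitAddTorus

/-- The Cayley transform `x ↦ (x - i) / (x + i)` with values in `ℝ / ℤ`. -/
noncomputable def cayley (x : ℝ) : UnitAddCircle :=
  (AddCircle.homeomorphCircle one_ne_zero).symm
    (Circle.ofConjDivSelf ((x : ℂ) + Complex.I) (ofReal_add_I_ne_zero x))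

lemma toCircle_cayley (x : ℝ) :
    ((cayley x).toCircle : ℂ) = (x - Complex.I) / (x + Complex.I) := by
  rw [cayley, ← AddCircle.homeomorphCircle_apply one_ne_zero, Homeomorph.apply_symm_apply]
  change (starRingEnd ℂ) ((x : ℂ) + Complex.I) / ((x : ℂ) + Complex.I) = _
  simp [← sub_eq_add_neg]

lemma continuous_cayley : Continuous cayley := by
  refine (Homeomorph.continuous _).comp ?_
  refine (Topology.IsEmbedding.continuous_iff (g := ((↑) : Circle → ℂ))
    Topology.IsEmbedding.subtypeVal).2 ?_
  change Continuous fun x : ℝ =>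
    (starRingEnd ℂ) ((x : ℂ) + Complex.I) / ((x : ℂ) + Complex.I)
  exact Continuous.div (by fun_prop) (by fun_prop) ofReal_add_I_ne_zero

/-- The inverse Cayley transform `z ↦ i (1 + z) / (1 - z)`, with the value `0` at `z = 1`. -/
noncomputable def invCayley (θ : UnitAddCircle) : ℝ :=
  (Complex.I * (1 + (θ.toCircle : ℂ)) / (1 - (θ.toCircle : ℂ))).re

lemma continuous_coe_toCircle : Continuous fun θ : UnitAddCircle => (θ.toCircle : ℂ) :=
  continuous_subtype_val.comp AddCircle.continuous_toCircle

lemma measurable_invCayley : Measurable invCayley := by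
  have := continuous_coe_toCircle.measurable
  unfold invCayley
  fun_prop

lemma conj_toCircle (θ : UnitAddCircle) :
    (starRingEnd ℂ) (θ.toCircle : ℂ) = (θ.toCircle : ℂ)⁻¹ := by
  rw [← Circle.coe_inv, Circle.coe_inv_eq_conj]

lemma ofReal_invCayley {θ : UnitAddCircle} (h : (θ.toCircle : ℂ) ≠ 1) :
    (invCayley θ : ℂ) =
      Complex.I * (1 + (θ.toCircle : ℂ)) / (1 - (θ.toCircle : ℂ)) := by
  have h0 : (θ.toCircle : ℂ) ≠ 0 := Circle.coe_ne_zero _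
  have h1 : 1 - (θ.toCircle : ℂ) ≠ 0 := sub_ne_zero.2 h.symm
  have h2 : (θ.toCircle : ℂ) - 1 ≠ 0 := sub_ne_zero.2 h
  refine Complex.conj_eq_iff_re.1 ?_
  simp only [map_div₀, map_mul, map_add, map_sub, map_one, Complex.conj_I, conj_toCircle]
  rw [div_eq_div_iff (by field_simp; exact div_ne_zero h2 h0) h1]
  field_simp
  ring

lemma invCayley_cayley (x : ℝ) : invCayley (cayley x) = x := by
  have h1 := ofReal_add_I_ne_zero x
  have h : Complex.I * (1 + ((cayley x).toCircle : ℂ)) / (1 - ((cayley x).toCircle : ℂ)) = x := by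
    rw [toCircle_cayley]
    have h2 : 1 - ((x : ℂ) - Complex.I) / (x + Complex.I) = 2 * Complex.I / (x + Complex.I) := by
      field_simp; ring
    rw [h2]
    have := Complex.I_ne_zero
    field_simp
    ring
  rw [invCayley, h, Complex.ofReal_re]

/-- The function `|1 - z|² / 4` on the circle; it is `(1 + x²)⁻¹` for `z = (x - i) / (x + i)`. -/
noncomputable def cayleyWeight (θ : UnitAddCircle) : ℝ :=
  Complex.normSq (1 - (θ.toCircle : ℂ)) / 4

lemma cayleyWeight_nonneg (θ : UnitAddCircle) : 0 ≤ cayleyWeight θ :=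
  div_nonneg (Complex.normSq_nonneg _) (by norm_num)

lemma continuous_cayleyWeight : Continuous cayleyWeight := by
  unfold cayleyWeight
  exact (Complex.continuous_normSq.comp (continuous_const.sub continuous_coe_toCircle)).div_const _

lemma ofReal_cayleyWeight (θ : UnitAddCircle) :
    (cayleyWeight θ : ℂ) = (2 - (θ.toCircle : ℂ) - (θ.toCircle : ℂ)⁻¹) / 4 := by
  have h0 : (θ.toCircle : ℂ) ≠ 0 := Circle.coe_ne_zero _
  rw [cayleyWeight]
  push_cast
  rw [← Complex.mul_conj, map_sub, map_one, conj_toCircle]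
  field_simp
  ring

lemma toCircle_ne_one_of_cayleyWeight_ne_zero {θ : UnitAddCircle} (h : cayleyWeight θ ≠ 0) :
    (θ.toCircle : ℂ) ≠ 1 := by
  rintro h1
  simp [cayleyWeight, h1] at h

lemma invCayley_zpow_mul_weight {θ : UnitAddCircle} (h : (θ.toCircle : ℂ) ≠ 1) (N : ℕ) (j : ℤ) :
    ((invCayley θ : ℂ) + Complex.I) ^ ((N : ℤ) - j) *
      ((invCayley θ : ℂ) - Complex.I) ^ ((N : ℤ) + j) * (cayleyWeight θ : ℂ) ^ N =
      (θ.toCircle : ℂ) ^ j := by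
  have h0 : (θ.toCircle : ℂ) ≠ 0 := Circle.coe_ne_zero _
  have h1 : 1 - (θ.toCircle : ℂ) ≠ 0 := sub_ne_zero.2 h.symm
  have hI := Complex.I_ne_zero
  have ha : (invCayley θ : ℂ) + Complex.I = 2 * Complex.I / (1 - (θ.toCircle : ℂ)) := by
    rw [ofReal_invCayley h]; field_simp; ring
  have hb : (invCayley θ : ℂ) - Complex.I =
      ((invCayley θ : ℂ) + Complex.I) * (θ.toCircle : ℂ) := by
    rw [ofReal_invCayley h]; field_simp; ring
  have hc : ((invCayley θ : ℂ) + Complex.I) ^ 2 * (θ.toCircle : ℂ) * (cayleyWeight θ : ℂ) = 1 := by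
    rw [ha, ofReal_cayleyWeight]
    field_simp
    rw [Complex.I_sq]
    ring
  have hd := ofReal_add_I_ne_zero (invCayley θ)
  set u := (invCayley θ : ℂ) + Complex.I
  rw [hb, mul_zpow, ← mul_assoc, ← zpow_add₀ hd, zpow_add₀ h0]
  have he : (N : ℤ) - j + (N + j) = ((2 * N : ℕ) : ℤ) := by push_cast; ring
  rw [he, zpow_natCast, zpow_natCast, pow_mul]
  calc _ = (u ^ 2 * (θ.toCircle : ℂ) * (cayleyWeight θ : ℂ)) ^ N * (θ.toCircle : ℂ) ^ j := by
        rw [mul_pow, mul_pow]; ring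
    _ = _ := by rw [hc, one_pow, one_mul]

lemma fourier_eq_toCircle_zpow (n : ℤ) (θ : UnitAddCircle) :
    fourier n θ = (θ.toCircle : ℂ) ^ n := by
  rw [fourier_apply, AddCircle.toCircle_zsmul, Circle.coe_zpow]

lemma mFourier_fin_two (j : Fin 2 → ℤ) (θ : UnitAddTorus (Fin 2)) :
    mFourier j θ = ((θ 0).toCircle : ℂ) ^ j 0 * ((θ 1).toCircle : ℂ) ^ j 1 := by
  change ∏ i, fourier (j i) (θ i) = _
  simp [fourier_eq_toCircle_zpow, Fin.prod_univ_two, -fourier_apply]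

end Cayley

/-! ### The extended moment problem -/

section Extended

open UnitAddTorus Filter Topology

/-- The relations between the numbers `φ a = ∫ y_a dμ` which come from `x₁ y_a ± i y_a` being the
function `y` of the index with `k`, respectively `l`, raised by one, and from its analogue for the
second variable. -/
def ScalarShiftRelations (φ : Idx → ℂ) : Prop :=
  ∀ a : Idx,
    φ {a with m := a.m + 1} + Complex.I * φ a = φ {a with k := a.k + 1} ∧
    φ {a with m := a.m + 1} - Complex.I * φ a = φ {a with l := a.l + 1} ∧
    φ {a with n := a.n + 1} + Complex.I * φ a = φ {a with r := a.r + 1} ∧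
    φ {a with n := a.n + 1} - Complex.I * φ a = φ {a with t := a.t + 1}

/-- The numbers `∫ z₁^{j₁} z₂^{j₂} (1 + x₁²)^{N₁} (1 + x₂²)^{N₂} dμ`, where `z` is the Cayley
transform of `x`, expressed through the moments `φ` of `μ`. -/
def weightedCoeff (φ : Idx → ℂ) (N₁ N₂ : ℕ) (j : Fin 2 → ℤ) : ℂ :=
  φ ⟨0, N₁ - j 0, N₁ + j 0, 0, N₂ - j 1, N₂ + j 1⟩

variable {φ : Idx → ℂ}

lemma ScalarShiftRelations.weightedCoeff_first (hφ : ScalarShiftRelations φ) (N₁ N₂ : ℕ)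
    (j : Fin 2 → ℤ) :
    (2 * weightedCoeff φ (N₁ + 1) N₂ j - weightedCoeff φ (N₁ + 1) N₂ (j + Pi.single 0 1) -
      weightedCoeff φ (N₁ + 1) N₂ (j - Pi.single 0 1)) / 4 = weightedCoeff φ N₁ N₂ j := by
  -- apply `(x + i) - (x - i) = 2i` twice to get `4 = 2 (x + i) (x - i) - (x + i)² - (x - i)²`
  have key : ∀ a : Idx, φ {a with k := a.k + 1} - φ {a with l := a.l + 1} = 2 * Complex.I * φ a :=
    fun a => by linear_combination (hφ a).2.1 - (hφ a).1
  have h0 := key ⟨0, N₁ - j 0, N₁ + j 0, 0, N₂ - j 1, N₂ + j 1⟩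
  have h1 := key ⟨0, N₁ - j 0 + 1, N₁ + j 0, 0, N₂ - j 1, N₂ + j 1⟩
  have h2 := key ⟨0, N₁ - j 0, N₁ + j 0 + 1, 0, N₂ - j 1, N₂ + j 1⟩
  have e1 : weightedCoeff φ (N₁ + 1) N₂ j =
      φ ⟨0, N₁ - j 0 + 1, N₁ + j 0 + 1, 0, N₂ - j 1, N₂ + j 1⟩ := by
    simp only [weightedCoeff]; congr 2 <;> push_cast <;> ring
  have e2 : weightedCoeff φ (N₁ + 1) N₂ (j + Pi.single 0 1) =
      φ ⟨0, N₁ - j 0, N₁ + j 0 + 1 + 1, 0, N₂ - j 1, N₂ + j 1⟩ := by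
    simp only [weightedCoeff]; congr 2 <;> simp
    ring
  have e3 : weightedCoeff φ (N₁ + 1) N₂ (j - Pi.single 0 1) =
      φ ⟨0, N₁ - j 0 + 1 + 1, N₁ + j 0, 0, N₂ - j 1, N₂ + j 1⟩ := by
    simp only [weightedCoeff]; congr 2 <;> simp
    ring
  have e4 : weightedCoeff φ N₁ N₂ j = φ ⟨0, N₁ - j 0, N₁ + j 0, 0, N₂ - j 1, N₂ + j 1⟩ := rfl
  rw [e1, e2, e3, e4]
  simp only at h0 h1 h2
  linear_combination (-1 / 4) * h1 + (1 / 4) * h2 - (Complex.I / 2) * h0 -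
    φ ⟨0, N₁ - j 0, N₁ + j 0, 0, N₂ - j 1, N₂ + j 1⟩ * Complex.I_sq

lemma ScalarShiftRelations.weightedCoeff_second (hφ : ScalarShiftRelations φ) (N₁ N₂ : ℕ)
    (j : Fin 2 → ℤ) :
    (2 * weightedCoeff φ N₁ (N₂ + 1) j - weightedCoeff φ N₁ (N₂ + 1) (j + Pi.single 1 1) -
      weightedCoeff φ N₁ (N₂ + 1) (j - Pi.single 1 1)) / 4 = weightedCoeff φ N₁ N₂ j := by
  have key : ∀ a : Idx, φ {a with r := a.r + 1} - φ {a with t := a.t + 1} = 2 * Complex.I * φ a :=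
    fun a => by linear_combination (hφ a).2.2.2 - (hφ a).2.2.1
  have h0 := key ⟨0, N₁ - j 0, N₁ + j 0, 0, N₂ - j 1, N₂ + j 1⟩
  have h1 := key ⟨0, N₁ - j 0, N₁ + j 0, 0, N₂ - j 1 + 1, N₂ + j 1⟩
  have h2 := key ⟨0, N₁ - j 0, N₁ + j 0, 0, N₂ - j 1, N₂ + j 1 + 1⟩
  have e1 : weightedCoeff φ N₁ (N₂ + 1) j =
      φ ⟨0, N₁ - j 0, N₁ + j 0, 0, N₂ - j 1 + 1, N₂ + j 1 + 1⟩ := by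
    simp only [weightedCoeff]; congr 2 <;> push_cast <;> ring
  have e2 : weightedCoeff φ N₁ (N₂ + 1) (j + Pi.single 1 1) =
      φ ⟨0, N₁ - j 0, N₁ + j 0, 0, N₂ - j 1, N₂ + j 1 + 1 + 1⟩ := by
    simp only [weightedCoeff]; congr 2 <;> simp
    ring
  have e3 : weightedCoeff φ N₁ (N₂ + 1) (j - Pi.single 1 1) =
      φ ⟨0, N₁ - j 0, N₁ + j 0, 0, N₂ - j 1 + 1 + 1, N₂ + j 1⟩ := by
    simp only [weightedCoeff]; congr 2 <;> simp
    ring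
  have e4 : weightedCoeff φ N₁ N₂ j = φ ⟨0, N₁ - j 0, N₁ + j 0, 0, N₂ - j 1, N₂ + j 1⟩ := rfl
  rw [e1, e2, e3, e4]
  simp only at h0 h1 h2
  linear_combination (-1 / 4) * h1 + (1 / 4) * h2 - (Complex.I / 2) * h0 -
    φ ⟨0, N₁ - j 0, N₁ + j 0, 0, N₂ - j 1, N₂ + j 1⟩ * Complex.I_sq

lemma mFourier_mul_cayleyWeight (i : Fin 2) (j : Fin 2 → ℤ) (θ : UnitAddTorus (Fin 2)) :
    (cayleyWeight (θ i) : ℂ) * mFourier j θ =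
      (2 * mFourier j θ - mFourier (j + Pi.single i 1) θ - mFourier (j - Pi.single i 1) θ) / 4 := by
  have h : ((θ i).toCircle : ℂ) = mFourier (Pi.single i 1) θ := by
    rw [mFourier_single, fourier_one]
  rw [ofReal_cayleyWeight, sub_eq_add_neg j, mFourier_add, mFourier_add, mFourier_neg, ← h,
    conj_toCircle]
  ring

lemma integral_withDensity_cayleyWeight (ν : Measure (UnitAddTorus (Fin 2))) [IsFiniteMeasure ν]
    (i : Fin 2) (j : Fin 2 → ℤ) :
    ∫ θ, mFourier j θ ∂(ν.withDensity fun θ => ENNReal.ofReal (cayleyWeight (θ i))) =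
      (2 * ∫ θ, mFourier j θ ∂ν - ∫ θ, mFourier (j + Pi.single i 1) θ ∂ν -
        ∫ θ, mFourier (j - Pi.single i 1) θ ∂ν) / 4 := by
  have hint : ∀ j : Fin 2 → ℤ, Integrable (fun θ => mFourier j θ) ν := fun j =>
    Continuous.integrable_of_hasCompactSupport (by fun_prop) (HasCompactSupport.of_compactSpace _)
  have hm : Measurable fun θ : UnitAddTorus (Fin 2) => ENNReal.ofReal (cayleyWeight (θ i)) :=
    (continuous_cayleyWeight.comp (continuous_apply i)).measurable.ennreal_ofReal
  rw [integral_withDensity_eq_integral_toReal_smul hm (by simp)]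
  simp_rw [ENNReal.toReal_ofReal (cayleyWeight_nonneg _), Complex.real_smul,
    mFourier_mul_cayleyWeight]
  have h1 : Integrable (fun θ => 2 * mFourier j θ - mFourier (j + Pi.single i 1) θ) ν :=
    ((hint _).const_mul 2).sub (hint _)
  rw [integral_div, integral_sub h1 (hint _),
    integral_sub ((hint _).const_mul 2) (hint _), integral_const_mul]

/-- The density `((1 + x₁²)^{N₁} (1 + x₂²)^{N₂})⁻¹` on the torus. -/
noncomputable def torusWeight (N₁ N₂ : ℕ) (θ : UnitAddTorus (Fin 2)) : ℝ :=
  cayleyWeight (θ 0) ^ N₁ * cayleyWeight (θ 1) ^ N₂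

lemma torusWeight_nonneg (N₁ N₂ : ℕ) (θ : UnitAddTorus (Fin 2)) : 0 ≤ torusWeight N₁ N₂ θ :=
  mul_nonneg (pow_nonneg (cayleyWeight_nonneg _) _) (pow_nonneg (cayleyWeight_nonneg _) _)

lemma continuous_torusWeight (N₁ N₂ : ℕ) : Continuous (torusWeight N₁ N₂) := by
  have := continuous_cayleyWeight
  unfold torusWeight
  fun_prop

lemma measurable_ofReal_torusWeight (N₁ N₂ : ℕ) :
    Measurable fun θ => ENNReal.ofReal (torusWeight N₁ N₂ θ) :=
  (continuous_torusWeight N₁ N₂).measurable.ennreal_ofReal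

/-- The measures `ν_{N₁,N₂}` on the torus with the Fourier coefficients `weightedCoeff φ N₁ N₂`
arise from each other by multiplication with the weights. -/
lemma withDensity_torusWeight (hφ : ScalarShiftRelations φ)
    {ν : ℕ → ℕ → Measure (UnitAddTorus (Fin 2))} [∀ N₁ N₂, IsFiniteMeasure (ν N₁ N₂)]
    (hν : ∀ N₁ N₂ j, ∫ θ, mFourier j θ ∂(ν N₁ N₂) = weightedCoeff φ N₁ N₂ j) (K₁ K₂ N₁ N₂ : ℕ) :
    (ν (K₁ + N₁) (K₂ + N₂)).withDensity (fun θ => ENNReal.ofReal (torusWeight N₁ N₂ θ)) =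
      ν K₁ K₂ := by
  have hcont : ∀ i : Fin 2, Continuous fun θ : UnitAddTorus (Fin 2) => cayleyWeight (θ i) :=
    fun i => continuous_cayleyWeight.comp (continuous_apply i)
  have hfin : ∀ (ρ : Measure (UnitAddTorus (Fin 2))) [IsFiniteMeasure ρ] (i : Fin 2),
      IsFiniteMeasure (ρ.withDensity fun θ => ENNReal.ofReal (cayleyWeight (θ i))) := fun ρ _ i =>
    isFiniteMeasure_withDensity_ofReal (Continuous.integrable_of_hasCompactSupport (hcont i)
      (HasCompactSupport.of_compactSpace _)).hasFiniteIntegral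
  have hmeas : ∀ i : Fin 2,
      Measurable fun θ : UnitAddTorus (Fin 2) => ENNReal.ofReal (cayleyWeight (θ i)) := fun i =>
    (hcont i).measurable.ennreal_ofReal
  have h1 : ∀ K₁ K₂, (ν (K₁ + 1) K₂).withDensity
      (fun θ => ENNReal.ofReal (cayleyWeight (θ 0))) = ν K₁ K₂ := by
    intro K₁ K₂
    have := hfin (ν (K₁ + 1) K₂) 0
    refine measure_ext_of_mFourier fun j => ?_
    rw [integral_withDensity_cayleyWeight, hν, hν, hν, hν, hφ.weightedCoeff_first]
  have h2 : ∀ K₁ K₂, (ν K₁ (K₂ + 1)).withDensity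
      (fun θ => ENNReal.ofReal (cayleyWeight (θ 1))) = ν K₁ K₂ := by
    intro K₁ K₂
    have := hfin (ν K₁ (K₂ + 1)) 1
    refine measure_ext_of_mFourier fun j => ?_
    rw [integral_withDensity_cayleyWeight, hν, hν, hν, hν, hφ.weightedCoeff_second]
  induction N₁ with
  | zero =>
    induction N₂ with
    | zero => simp [torusWeight]
    | succ N₂ ih =>
      rw [← ih, ← h2 (K₁ + 0) (K₂ + N₂), ← withDensity_mul _ (hmeas 1)
        (measurable_ofReal_torusWeight _ _)]
      congr 1
      funext θ
      rw [Pi.mul_apply, ← ENNReal.ofReal_mul (cayleyWeight_nonneg _)]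
      congr 1
      simp only [torusWeight]; ring
  | succ N₁ ih =>
    rw [← ih, ← h1 (K₁ + N₁) (K₂ + N₂), ← withDensity_mul _ (hmeas 0)
      (measurable_ofReal_torusWeight _ _)]
    congr 1
    funext θ
    rw [Pi.mul_apply, ← ENNReal.ofReal_mul (cayleyWeight_nonneg _)]
    congr 1
    simp only [torusWeight]; ring

/-- Lifts a property of the pairs with even nonnegative sum to all pairs of integers. -/
lemma forall_int_pair_of_raise {Q : ℤ → ℤ → Prop}
    (hraise : ∀ k l, Q (k + 1) l → Q k (l + 1) → Q k l)
    (heven : ∀ (N : ℕ) (k l : ℤ), k + l = 2 * N → Q k l) (k l : ℤ) : Q k l := by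
  have h : ∀ (d N : ℕ) (k l : ℤ), k + l + d = 2 * N → Q k l := by
    intro d N
    induction d with
    | zero => intro k l h; exact heven N k l (by simpa using h)
    | succ d ih =>
      intro k l h
      push_cast at h
      exact hraise k l (ih _ _ (by linarith)) (ih _ _ (by linarith))
  refine h (2 * (k + l).natAbs - (k + l)).toNat (k + l).natAbs k l ?_
  omega

/-- The extended moment problem is solvable if its data satisfy the shift relations and the
positivity on the torus. The solution is the measure `ν_{0,0}` on the torus carried over to the
plane; it does not charge the points at infinity, since it has the density
`((1 + x₁²)(1 + x₂²))⁻¹` with respect to `ν_{1,1}`. -/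
theorem exists_solvesExt (hφ : ScalarShiftRelations φ)
    (hpos : ∀ N₁ N₂, IsPosDefSeq (weightedCoeff φ N₁ N₂)) :
    ∃ μ : Measure (ℝ × ℝ), SolvesExt φ μ := by
  choose ν hfin hν using fun N₁ N₂ => (hpos N₁ N₂).exists_measure
  have hdens := withDensity_torusWeight hφ hν
  -- no mass at infinity: `ν_{N₁,N₂}` has a density which vanishes there
  have hae : ∀ N₁ N₂, ∀ᵐ θ ∂(ν N₁ N₂),
      ((θ 0).toCircle : ℂ) ≠ 1 ∧ ((θ 1).toCircle : ℂ) ≠ 1 := by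
    intro N₁ N₂
    rw [← hdens N₁ N₂ 1 1, ae_withDensity_iff (measurable_ofReal_torusWeight 1 1)]
    refine Filter.Eventually.of_forall fun θ h => ?_
    have h1 : torusWeight 1 1 θ ≠ 0 := fun h0 => h (by rw [h0, ENNReal.ofReal_zero])
    simp only [torusWeight, pow_one] at h1
    exact ⟨toCircle_ne_one_of_cayleyWeight_ne_zero (left_ne_zero_of_mul h1),
      toCircle_ne_one_of_cayleyWeight_ne_zero (right_ne_zero_of_mul h1)⟩
  set ψ : UnitAddTorus (Fin 2) → ℝ × ℝ := fun θ => (invCayley (θ 0), invCayley (θ 1)) with hψdef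
  have hψ : Measurable ψ :=
    (measurable_invCayley.comp (measurable_pi_apply 0)).prodMk
      (measurable_invCayley.comp (measurable_pi_apply 1))
  refine ⟨(ν 0 0).map ψ, ?_⟩
  set P : Idx → Prop := fun a => Integrable (extMonomial a) ((ν 0 0).map ψ) ∧
    ∫ x, extMonomial a x ∂((ν 0 0).map ψ) = φ a with hP
  -- these indices belong to the functions `z₁^{j₁} z₂^{j₂} (1 + x₁²)^{N₁} (1 + x₂²)^{N₂}`
  have hbase : ∀ (N₁ N₂ : ℕ) (j : Fin 2 → ℤ),
      P ⟨0, N₁ - j 0, N₁ + j 0, 0, N₂ - j 1, N₂ + j 1⟩ := by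
    intro N₁ N₂ j
    set a : Idx := ⟨0, N₁ - j 0, N₁ + j 0, 0, N₂ - j 1, N₂ + j 1⟩ with ha
    have hd := hdens 0 0 N₁ N₂
    rw [zero_add, zero_add] at hd
    have heq : (fun θ => (ENNReal.ofReal (torusWeight N₁ N₂ θ)).toReal • extMonomial a (ψ θ))
        =ᵐ[ν N₁ N₂] fun θ => mFourier j θ := by
      filter_upwards [hae N₁ N₂] with θ hθ
      rw [ENNReal.toReal_ofReal (torusWeight_nonneg _ _ _), Complex.real_smul, mFourier_fin_two,
        ← invCayley_zpow_mul_weight hθ.1 N₁, ← invCayley_zpow_mul_weight hθ.2 N₂]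
      simp only [extMonomial, ha, hψdef, torusWeight]
      push_cast
      ring
    have hsm : AEStronglyMeasurable (extMonomial a) ((ν 0 0).map ψ) :=
      (continuous_extMonomial a).aestronglyMeasurable
    constructor
    · rw [integrable_map_measure hsm hψ.aemeasurable, ← hd,
        integrable_withDensity_iff_integrable_smul' (measurable_ofReal_torusWeight _ _) (by simp)]
      exact (Continuous.integrable_of_hasCompactSupport (by fun_prop)
        (HasCompactSupport.of_compactSpace _) : Integrable (fun θ => mFourier j θ)
          (ν N₁ N₂)).congr heq.symm
    · rw [integral_map hψ.aemeasurable hsm, ← hd, integral_withDensity_eq_integral_toReal_smul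
        (measurable_ofReal_torusWeight _ _) (by simp), integral_congr_ae heq, hν]
      rfl
  -- the remaining indices are reached by `2i y = (x + i) y - (x - i) y` and `x y = (x + i) y - i y`
  have hlin : ∀ (a b c : Idx) (α β : ℂ),
      (∀ x, extMonomial a x = α * extMonomial b x + β * extMonomial c x) →
      φ a = α * φ b + β * φ c → P b → P c → P a := by
    intro a b c α β h1 h2 hb hc
    have h3 : extMonomial a = fun x => α * extMonomial b x + β * extMonomial c x := funext h1
    refine ⟨h3 ▸ (hb.1.const_mul α).add (hc.1.const_mul β), ?_⟩
    rw [h3, integral_add (hb.1.const_mul α) (hc.1.const_mul β), integral_const_mul,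
      integral_const_mul, hb.2, hc.2, h2]
  have h2I : Complex.I * Complex.I = -1 := Complex.I_mul_I
  have hraise₁ : ∀ a : Idx, P {a with k := a.k + 1} → P {a with l := a.l + 1} → P a := by
    refine fun a => hlin _ _ _ (-Complex.I / 2) (Complex.I / 2) (fun x => ?_) ?_
    · rw [← (extMonomial_shift a x).1, ← (extMonomial_shift a x).2.1]
      linear_combination extMonomial a x * h2I
    · rw [← (hφ a).1, ← (hφ a).2.1]
      linear_combination φ a * h2I
  have hraise₂ : ∀ a : Idx, P {a with r := a.r + 1} → P {a with t := a.t + 1} → P a := by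
    refine fun a => hlin _ _ _ (-Complex.I / 2) (Complex.I / 2) (fun x => ?_) ?_
    · rw [← (extMonomial_shift a x).2.2.1, ← (extMonomial_shift a x).2.2.2]
      linear_combination extMonomial a x * h2I
    · rw [← (hφ a).2.2.1, ← (hφ a).2.2.2]
      linear_combination φ a * h2I
  have hpow₁ : ∀ a : Idx, P {a with k := a.k + 1} → P a → P {a with m := a.m + 1} := by
    refine fun a => hlin _ _ _ 1 (-Complex.I) (fun x => ?_) ?_
    · rw [← (extMonomial_shift a x).1]; ring
    · rw [← (hφ a).1]; ring
  have hpow₂ : ∀ a : Idx, P {a with r := a.r + 1} → P a → P {a with n := a.n + 1} := by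
    refine fun a => hlin _ _ _ 1 (-Complex.I) (fun x => ?_) ?_
    · rw [← (extMonomial_shift a x).2.2.1]; ring
    · rw [← (hφ a).2.2.1]; ring
  have h00 : ∀ k l r t : ℤ, P ⟨0, k, l, 0, r, t⟩ := by
    intro k l r t
    refine forall_int_pair_of_raise (Q := fun k l => P ⟨0, k, l, 0, r, t⟩)
      (fun k l => hraise₁ ⟨0, k, l, 0, r, t⟩) (fun N₁ k l hkl => ?_) k l
    refine forall_int_pair_of_raise (Q := fun r t => P ⟨0, k, l, 0, r, t⟩)
      (fun r t => hraise₂ ⟨0, k, l, 0, r, t⟩) (fun N₂ r t hrt => ?_) r t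
    have h := hbase N₁ N₂ ![N₁ - k, N₂ - r]
    simp only [Matrix.cons_val_zero, Matrix.cons_val_one] at h
    convert h using 2 <;> linarith
  have h0 : ∀ (m : ℕ) (k l r t : ℤ), P ⟨m, k, l, 0, r, t⟩ := by
    intro m
    induction m with
    | zero => exact h00
    | succ m ih => exact fun k l r t => hpow₁ ⟨m, k, l, 0, r, t⟩ (ih _ _ _ _) (ih _ _ _ _)
  have h : ∀ (n m : ℕ) (k l r t : ℤ), P ⟨m, k, l, n, r, t⟩ := by
    intro n
    induction n with
    | zero => exact h0
    | succ n ih => exact fun m k l r t => hpow₂ ⟨m, k, l, n, r, t⟩ (ih _ _ _ _ _) (ih _ _ _ _ _)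
  exact fun a => h a.n a.m a.k a.l a.r a.t

lemma SolvesExt.isFiniteMeasure {μ : Measure (ℝ × ℝ)} (h : SolvesExt φ μ) : IsFiniteMeasure μ := by
  have h1 := (h ⟨0, 0, 0, 0, 0, 0⟩).1
  have h2 : extMonomial ⟨0, 0, 0, 0, 0, 0⟩ = fun _ => (1 : ℂ) := by
    funext x; simp [extMonomial_omega0]
  rw [h2, integrable_const_iff] at h1
  exact h1.resolve_left one_ne_zero

/-- The extended moment problem has at most one solution, because the functions
`((x₁ - i) / (x₁ + i))^{j₁} ((x₂ - i) / (x₂ + i))^{j₂}` are among its test functions. -/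
theorem SolvesExt.unique {μ μ' : Measure (ℝ × ℝ)} (h : SolvesExt φ μ) (h' : SolvesExt φ μ') :
    μ = μ' := by
  set κ : ℝ × ℝ → UnitAddTorus (Fin 2) := fun x => ![cayley x.1, cayley x.2] with hκdef
  set ψ : UnitAddTorus (Fin 2) → ℝ × ℝ := fun θ => (invCayley (θ 0), invCayley (θ 1)) with hψdef
  have hψ : Measurable ψ :=
    (measurable_invCayley.comp (measurable_pi_apply 0)).prodMk
      (measurable_invCayley.comp (measurable_pi_apply 1))
  have hκ : Measurable κ := by
    refine measurable_pi_iff.2 fun i => ?_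
    fin_cases i
    · exact continuous_cayley.measurable.comp measurable_fst
    · exact continuous_cayley.measurable.comp measurable_snd
  have hψκ : ψ ∘ κ = id := by
    funext x
    simp [hψdef, hκdef, invCayley_cayley]
  have hcoeff : ∀ (ρ : Measure (ℝ × ℝ)), SolvesExt φ ρ → ∀ j,
      ∫ θ, mFourier j θ ∂(ρ.map κ) = φ ⟨0, -j 0, j 0, 0, -j 1, j 1⟩ := by
    intro ρ hρ j
    rw [integral_map hκ.aemeasurable (mFourier j).continuous.aestronglyMeasurable,
      ← (hρ _).2]
    congr 1
    funext x
    rw [mFourier_fin_two]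
    simp only [hκdef, Matrix.cons_val_zero, Matrix.cons_val_one, toCircle_cayley, extMonomial,
      pow_zero, one_mul, zpow_neg, div_zpow]
    ring
  have := h.isFiniteMeasure
  have := h'.isFiniteMeasure
  have heq : μ.map κ = μ'.map κ :=
    measure_ext_of_mFourier fun j => by rw [hcoeff μ h, hcoeff μ' h']
  have hback : ∀ ρ : Measure (ℝ × ℝ), (ρ.map κ).map ψ = ρ := fun ρ => by
    rw [Measure.map_map hψ hκ, hψκ, Measure.map_id]
  rw [← hback μ, heq, hback μ']

variable {𝓗 : Type*} [NormedAddCommGroup 𝓗] [InnerProductSpace ℂ 𝓗] {H : Idx → 𝓗}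

lemma HasGramFunction.apply_eq (h : HasGramFunction H φ) (a : Idx) :
    φ a = ip (H a) (H ⟨0, 0, 0, 0, 0, 0⟩) := by
  rw [h]; simp

lemma HasGramFunction.scalarShiftRelations (h : HasGramFunction H φ) (hH : ShiftRelations H) :
    ScalarShiftRelations φ := by
  intro a
  simp only [h.apply_eq, ← (hH a).1, ← (hH a).2.1, ← (hH a).2.2.1, ← (hH a).2.2.2]
  refine ⟨?_, ?_, ?_, ?_⟩ <;>
    simp only [ip, inner_add_right, inner_sub_right, inner_smul_right]

lemma HasGramFunction.isPosDefSeq (h : HasGramFunction H φ) (N₁ N₂ : ℕ) :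
    IsPosDefSeq (weightedCoeff φ N₁ N₂) := by
  intro s α
  set v : (Fin 2 → ℤ) → 𝓗 := fun j => H ⟨0, N₁ - j 0, j 0, 0, N₂ - j 1, j 1⟩ with hv
  have h1 : ∀ j k, weightedCoeff φ N₁ N₂ (j - k) = ip (v j) (v k) := by
    intro j k
    rw [hv, h]
    simp only [weightedCoeff, Pi.sub_apply]
    congr 2 <;> ring
  have h2 : ∑ j ∈ s, ∑ k ∈ s, α j * (starRingEnd ℂ) (α k) * weightedCoeff φ N₁ N₂ (j - k) =
      ip (∑ j ∈ s, α j • v j) (∑ j ∈ s, α j • v j) := by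
    rw [ip, sum_inner, Finset.sum_comm]
    refine Finset.sum_congr rfl fun k _ => ?_
    rw [inner_sum]
    refine Finset.sum_congr rfl fun j _ => ?_
    rw [inner_smul_left, inner_smul_right, h1, ip]
    ring
  rw [h2, ip, inner_self_eq_norm_sq_to_K]
  exact Complex.zero_le_real.2 (sq_nonneg ‖_‖) |>.trans_eq (by push_cast; rfl)

/-- Shift relations and a Gram function yield a unique generated measure. -/
theorem existsUnique_generates (hH : ShiftRelations H) (h : HasGramFunction H φ) :
    ∃! μ, Generates H μ := by
  obtain ⟨μ, hμ⟩ := exists_solvesExt (h.scalarShiftRelations hH) h.isPosDefSeq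
  refine ⟨μ, ⟨φ, h, hμ⟩, ?_⟩
  rintro μ' ⟨φ', h', hμ'⟩
  have : φ' = φ := funext fun a => by rw [h'.apply_eq, h.apply_eq]
  exact SolvesExt.unique (this ▸ hμ') hμ

end Extended

/-! ### Relative Gram-Schmidt orthogonalization -/

section GramSchmidt

variable {E F I : Type*} [NormedAddCommGroup E] [InnerProductSpace ℂ E]
  [NormedAddCommGroup F] [InnerProductSpace ℂ F]

/-- Families with the same Gram matrix are related by an isometry of their closed spans. -/
theorem exists_isometry_of_gram_eq [CompleteSpace F] {x : I → E} {h : I → F}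
    (hgram : ∀ i j, inner ℂ (h i) (h j) = inner ℂ (x i) (x j)) :
    ∃ W : (Submodule.span ℂ (Set.range x)).topologicalClosure →ₗᵢ[ℂ] F,
      (∀ i (hi : x i ∈ (Submodule.span ℂ (Set.range x)).topologicalClosure), W ⟨x i, hi⟩ = h i) ∧
      ∀ u, W u ∈ (Submodule.span ℂ (Set.range h)).topologicalClosure := by
  have hmem : ∀ a : I →₀ ℂ, Finsupp.linearCombination ℂ x a ∈
      (Submodule.span ℂ (Set.range x)).topologicalClosure := fun a =>
    Submodule.le_topologicalClosure _ (by
      rw [← Finsupp.range_linearCombination]; exact LinearMap.mem_range_self _ a)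
  set e : (I →₀ ℂ) →ₗ[ℂ] (Submodule.span ℂ (Set.range x)).topologicalClosure :=
    (Finsupp.linearCombination ℂ x).codRestrict _ hmem with he
  set f : (I →₀ ℂ) →ₗ[ℂ] F := Finsupp.linearCombination ℂ h with hf
  have hdense : DenseRange e := by
    intro u
    rw [closure_subtype]
    have hu : (u : E) ∈ closure ((Submodule.span ℂ (Set.range x) : Submodule ℂ E) : Set E) := u.2
    convert hu using 2
    ext v
    have hv : v ∈ ((Submodule.span ℂ (Set.range x) : Submodule ℂ E) : Set E) ↔
        ∃ a, Finsupp.linearCombination ℂ x a = v := by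
      rw [← Finsupp.range_linearCombination]; rfl
    rw [hv]
    constructor
    · rintro ⟨_, ⟨a, rfl⟩, rfl⟩; exact ⟨a, rfl⟩
    · rintro ⟨a, rfl⟩; exact ⟨e a, ⟨a, rfl⟩, rfl⟩
  have hnorm : ∀ a, ‖f a‖ = ‖e a‖ := by
    intro a
    have h1 : inner ℂ (f a) (f a) = inner ℂ (e a) (e a) := by
      change inner ℂ (Finsupp.linearCombination ℂ h a) (Finsupp.linearCombination ℂ h a) =
        inner ℂ (Finsupp.linearCombination ℂ x a) (Finsupp.linearCombination ℂ x a)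
      simp only [Finsupp.linearCombination_apply, Finsupp.sum, sum_inner, inner_sum,
        inner_smul_left, inner_smul_right, hgram]
    rw [inner_self_eq_norm_sq_to_K, inner_self_eq_norm_sq_to_K] at h1
    have h2 : ‖f a‖ ^ 2 = ‖e a‖ ^ 2 := by exact_mod_cast h1
    exact (sq_eq_sq₀ (norm_nonneg _) (norm_nonneg _)).1 h2
  have hle : ∃ C, ∀ a, ‖f a‖ ≤ C * ‖e a‖ := ⟨1, fun a => by rw [one_mul, hnorm]⟩
  have hext : ∀ a, f.extendOfNorm e (e a) = f a := LinearMap.extendOfNorm_eq hdense hle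
  refine ⟨⟨(f.extendOfNorm e).toLinearMap, fun u => ?_⟩, fun i hi => ?_, fun u => ?_⟩
  · refine hdense.induction_on (p := fun u => ‖f.extendOfNorm e u‖ = ‖u‖) u
      (isClosed_eq (by fun_prop) (by fun_prop)) fun a => ?_
    rw [hext, hnorm]
  · have h1 := hext (Finsupp.single i 1)
    have h2 : e (Finsupp.single i 1) = ⟨x i, hi⟩ := Subtype.ext (by simp [he])
    rw [h2] at h1
    simpa [hf] using h1
  · refine hdense.induction_on
      (p := fun u => f.extendOfNorm e u ∈ (Submodule.span ℂ (Set.range h)).topologicalClosure) u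
      ((Submodule.isClosed_topologicalClosure _).preimage (f.extendOfNorm e).continuous)
      fun a => ?_
    rw [hext]
    refine Submodule.le_topologicalClosure _ ?_
    rw [← Finsupp.range_linearCombination]
    exact LinearMap.mem_range_self _ a

open InnerProductSpace in
lemma inner_gramSchmidt_self (z : ℕ → E) (r : ℕ) :
    inner ℂ (gramSchmidt ℂ z r) (z r) = (‖gramSchmidt ℂ z r‖ : ℂ) ^ 2 := by
  conv_lhs => rw [gramSchmidt_def'' ℂ z r]
  rw [inner_add_right, inner_sum, Finset.sum_eq_zero, add_zero, inner_self_eq_norm_sq_to_K]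
  · rfl
  · intro i hi
    rw [inner_smul_right, gramSchmidt_orthogonal ℂ z (Finset.mem_Iio.1 hi).ne', mul_zero]

open InnerProductSpace in
/-- The expansion of a sequence in its Gram-Schmidt vectors; vanishing Gram-Schmidt vectors are
permitted and do not contribute. -/
lemma eq_sum_inner_gramSchmidtNormed (z : ℕ → E) (r : ℕ) :
    z r = ∑ j ∈ Finset.range (r + 1),
      inner ℂ (gramSchmidtNormed ℂ z j) (z r) • gramSchmidtNormed ℂ z j := by
  have hterm : ∀ j, inner ℂ (gramSchmidtNormed ℂ z j) (z r) • gramSchmidtNormed ℂ z j =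
      (inner ℂ (gramSchmidt ℂ z j) (z r) / (‖gramSchmidt ℂ z j‖ : ℂ) ^ 2) •
        gramSchmidt ℂ z j := by
    intro j
    rw [gramSchmidtNormed, inner_smul_left, smul_smul]
    congr 1
    simp only [map_inv₀, RCLike.conj_ofReal]
    simp only [Complex.coe_algebraMap, div_eq_mul_inv, sq, mul_inv]
    ring
  have hlast : (inner ℂ (gramSchmidt ℂ z r) (z r) / (‖gramSchmidt ℂ z r‖ : ℂ) ^ 2) •
      gramSchmidt ℂ z r = gramSchmidt ℂ z r := by
    rw [inner_gramSchmidt_self]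
    by_cases h0 : gramSchmidt ℂ z r = 0
    · simp [h0]
    · rw [div_self (by simpa using h0), one_smul]
  simp_rw [hterm]
  rw [Finset.sum_range_succ, hlast, add_comm]
  conv_lhs => rw [gramSchmidt_def'' ℂ z r]
  congr 1
  refine Finset.sum_congr ?_ fun _ _ => rfl
  ext j; simp

open InnerProductSpace in
lemma inner_gramSchmidtNormed_self (z : ℕ → E) (r : ℕ) :
    inner ℂ (gramSchmidtNormed ℂ z r) (z r) = (‖gramSchmidt ℂ z r‖ : ℂ) := by
  rw [gramSchmidtNormed, inner_smul_left, inner_gramSchmidt_self]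
  by_cases h0 : gramSchmidt ℂ z r = 0
  · simp [h0]
  · have : (‖gramSchmidt ℂ z r‖ : ℂ) ≠ 0 := by simpa using h0
    simp only [map_inv₀, RCLike.conj_ofReal]
    simp only [Complex.coe_algebraMap]
    field_simp

open InnerProductSpace in
/-- Gram-Schmidt orthogonalization relative to a subspace, transplanted to another Hilbert space.
Let `h` have the Gram matrix of `x`, and let `e` be an orthonormal sequence orthogonal to `h`.
Then the sequence `y` has a copy `f` in triangular form with respect to the closed span of `h` and
the sequence `e`, with nonnegative diagonal, such that `(h, f)` has the Gram matrix of `(x, y)`.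
The vectors `e j` with vanishing diagonal entry are not used. -/
theorem exists_triangular_copy [CompleteSpace E] [CompleteSpace F] {x : I → E} {h : I → F}
    (hgram : ∀ i j, inner ℂ (h i) (h j) = inner ℂ (x i) (x j)) (y : ℕ → E) {e : ℕ → F}
    (he : Orthonormal ℂ e)
    (hort : ∀ u ∈ (Submodule.span ℂ (Set.range h)).topologicalClosure, ∀ j, inner ℂ (e j) u = 0) :
    ∃ (f p : ℕ → F) (β : ℕ → ℕ → ℂ),
      (∀ r, p r ∈ (Submodule.span ℂ (Set.range h)).topologicalClosure) ∧
      (∀ r, f r = p r + ∑ j ∈ Finset.range (r + 1), β r j • e j) ∧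
      (∀ r, 0 ≤ β r r) ∧ (∀ r j, β j j = 0 → β r j = 0) ∧
      (∀ r i, inner ℂ (f r) (h i) = inner ℂ (y r) (x i)) ∧
      ∀ r q, inner ℂ (f r) (f q) = inner ℂ (y r) (y q) := by
  have hW := exists_isometry_of_gram_eq hgram
  set U := (Submodule.span ℂ (Set.range x)).topologicalClosure with hU
  obtain ⟨W, hWx, hWmem⟩ := hW
  have : CompleteSpace U := (Submodule.isClosed_topologicalClosure _).completeSpace_coe
  have hxU : ∀ i, x i ∈ U := fun i =>
    Submodule.le_topologicalClosure _ (Submodule.subset_span ⟨i, rfl⟩)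
  have hhU : ∀ i, h i ∈ (Submodule.span ℂ (Set.range h)).topologicalClosure := fun i =>
    Submodule.le_topologicalClosure _ (Submodule.subset_span ⟨i, rfl⟩)
  set P : ℕ → U := fun r => U.orthogonalProjectionOnto (y r) with hP
  set z : ℕ → E := fun r => y r - P r with hz
  have hzU : ∀ r, ∀ u ∈ U, inner ℂ (z r) u = 0 := fun r u hu =>
    Submodule.inner_left_of_mem_orthogonal hu (Submodule.sub_starProjection_mem_orthogonal (y r))
  have hzU' : ∀ r, ∀ u ∈ U, inner ℂ u (z r) = 0 := fun r u hu => by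
    rw [← inner_conj_symm, hzU r u hu, map_zero]
  have hy : ∀ r, y r = P r + z r := fun r => by simp [hz]
  set β : ℕ → ℕ → ℂ := fun r j => inner ℂ (gramSchmidtNormed ℂ z j) (z r) with hβ
  have hzero : ∀ j, gramSchmidtNormed ℂ z j = 0 → ∀ r, β r j = 0 := fun j hj r => by
    simp [hβ, hj]
  have hort' : ∀ u ∈ (Submodule.span ℂ (Set.range h)).topologicalClosure, ∀ r,
      inner ℂ u (∑ j ∈ Finset.range (r + 1), β r j • e j) = 0 := by
    intro u hu r
    rw [inner_sum]
    refine Finset.sum_eq_zero fun j _ => ?_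
    rw [inner_smul_right, ← inner_conj_symm, hort u hu, map_zero, mul_zero]
  have hort'' : ∀ u ∈ (Submodule.span ℂ (Set.range h)).topologicalClosure, ∀ r,
      inner ℂ (∑ j ∈ Finset.range (r + 1), β r j • e j) u = 0 := by
    intro u hu r
    rw [← inner_conj_symm, hort' u hu, map_zero]
  refine ⟨fun r => W (P r) + ∑ j ∈ Finset.range (r + 1), β r j • e j, fun r => W (P r), β,
    fun r => hWmem _, fun r => rfl, fun r => ?_, fun r j hj => ?_, fun r i => ?_, fun r q => ?_⟩
  · simp only [hβ]
    rw [inner_gramSchmidtNormed_self]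
    exact Complex.zero_le_real.2 (norm_nonneg _)
  · refine hzero j ?_ r
    simp only [hβ] at hj
    rw [inner_gramSchmidtNormed_self] at hj
    have h0 : gramSchmidt ℂ z j = 0 := by simpa using hj
    rw [gramSchmidtNormed, h0, smul_zero]
  · rw [inner_add_left, hort'' _ (hhU i), add_zero, ← hWx i (hxU i), W.inner_map_map, hy r,
      inner_add_left, hzU r _ (hxU i), add_zero]
    rfl
  · have hterm : ∀ j k, inner ℂ (β r j • e j) (β q k • e k) =
        inner ℂ (β r j • gramSchmidtNormed ℂ z j) (β q k • gramSchmidtNormed ℂ z k) := by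
      intro j k
      by_cases hj : gramSchmidtNormed ℂ z j = 0
      · simp [hzero j hj]
      by_cases hk : gramSchmidtNormed ℂ z k = 0
      · simp [hzero k hk]
      have h1 := orthonormal_iff_ite.1 (gramSchmidtNormed_orthonormal' (𝕜 := ℂ) z) ⟨j, hj⟩ ⟨k, hk⟩
      simp only [Subtype.mk.injEq] at h1
      rw [inner_smul_left, inner_smul_right, inner_smul_left, inner_smul_right,
        orthonormal_iff_ite.1 he j k, h1]
    have hsum : inner ℂ (∑ j ∈ Finset.range (r + 1), β r j • e j)
        (∑ j ∈ Finset.range (q + 1), β q j • e j) = inner ℂ (z r) (z q) := by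
      rw [eq_sum_inner_gramSchmidtNormed z r, eq_sum_inner_gramSchmidtNormed z q]
      simp only [sum_inner, inner_sum]
      exact Finset.sum_congr rfl fun j _ => Finset.sum_congr rfl fun k _ => hterm _ _
    rw [inner_add_left, inner_add_right, inner_add_right, hort' _ (hWmem _), hort'' _ (hWmem _),
      hsum, W.inner_map_map, hy r, hy q, inner_add_left, inner_add_right, inner_add_right,
      hzU' q _ (P r).2, hzU r _ (P q).2]
    rfl

end GramSchmidt

/-! ### Linear conditions, and integrability of the extended monomials -/

section Conditions

variable {𝓗 : Type*} [NormedAddCommGroup 𝓗] [InnerProductSpace ℂ 𝓗] {H : Idx → 𝓗}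
  {φ : Idx → ℂ}

/-- Every single linear condition involves finitely many indices, so it suffices to know it from
some other system of linear conditions with the same scalar products of these indices. -/
lemma linearConditions_of_local {adm : Set Idx → Prop} {B : Idx → Idx → ℂ}
    (h : ∀ T : Set Idx, T.Finite → adm T → ∃ (adm' : Set Idx → Prop) (B' : Idx → Idx → ℂ),
      adm' T ∧ LinearConditions adm' B' ∧ ∀ a ∈ T, ∀ b ∈ T, B a b = B' a b) :
    LinearConditions adm B := by
  refine ⟨?_, ?_, ?_, ?_, ?_, ?_, ?_, ?_, ?_, ?_⟩
  · intro a b hT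
    obtain ⟨adm', B', h1, h2, h3⟩ := h _ (Set.toFinite _) hT
    rw [h3 _ (by simp) _ (by simp), h3 _ (by simp) _ (by simp), h3 _ (by simp) _ (by simp)]
    exact h2.1 a b h1
  · intro a b hT
    obtain ⟨adm', B', h1, h2, h3⟩ := h _ (Set.toFinite _) hT
    rw [h3 _ (by simp) _ (by simp), h3 _ (by simp) _ (by simp), h3 _ (by simp) _ (by simp)]
    exact h2.2.1 a b h1
  · intro a b hT
    obtain ⟨adm', B', h1, h2, h3⟩ := h _ (Set.toFinite _) hT
    rw [h3 _ (by simp) _ (by simp), h3 _ (by simp) _ (by simp), h3 _ (by simp) _ (by simp)]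
    exact h2.2.2.1 a b h1
  · intro a b hT
    obtain ⟨adm', B', h1, h2, h3⟩ := h _ (Set.toFinite _) hT
    rw [h3 _ (by simp) _ (by simp), h3 _ (by simp) _ (by simp), h3 _ (by simp) _ (by simp)]
    exact h2.2.2.2.1 a b h1
  · intro a b p q hs hT
    obtain ⟨adm', B', h1, h2, h3⟩ := h _ (Set.toFinite _) hT
    rw [h3 _ (by simp) _ (by simp), h3 _ (by simp) _ (by simp)]
    exact h2.2.2.2.2.1 a b p q hs h1
  · intro a b p q hs hT
    obtain ⟨adm', B', h1, h2, h3⟩ := h _ (Set.toFinite _) hT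
    rw [h3 _ (by simp) _ (by simp), h3 _ (by simp) _ (by simp)]
    exact h2.2.2.2.2.2.1 a b p q hs h1
  · intro a b p q hs hT
    obtain ⟨adm', B', h1, h2, h3⟩ := h _ (Set.toFinite _) hT
    rw [h3 _ (by simp) _ (by simp), h3 _ (by simp) _ (by simp)]
    exact h2.2.2.2.2.2.2.1 a b p q hs h1
  · intro a b p q hs hT
    obtain ⟨adm', B', h1, h2, h3⟩ := h _ (Set.toFinite _) hT
    rw [h3 _ (by simp) _ (by simp), h3 _ (by simp) _ (by simp)]
    exact h2.2.2.2.2.2.2.2.1 a b p q hs h1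
  · intro a b p q hs hT
    obtain ⟨adm', B', h1, h2, h3⟩ := h _ (Set.toFinite _) hT
    rw [h3 _ (by simp) _ (by simp), h3 _ (by simp) _ (by simp)]
    exact h2.2.2.2.2.2.2.2.2.1 a b p q hs h1
  · intro a b p q hs hT
    obtain ⟨adm', B', h1, h2, h3⟩ := h _ (Set.toFinite _) hT
    rw [h3 _ (by simp) _ (by simp), h3 _ (by simp) _ (by simp)]
    exact h2.2.2.2.2.2.2.2.2.2 a b p q hs h1

lemma HasGramFunction.linearConditions (h : HasGramFunction H φ) (hφ : ScalarShiftRelations φ)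
    (adm : Set Idx → Prop) : LinearConditions adm fun a b => ip (H a) (H b) := by
  have h' : ∀ a b : Idx, ip (H a) (H b) = φ (a.mulConj b) := h
  refine ⟨?_, ?_, ?_, ?_, ?_, ?_, ?_, ?_, ?_, ?_⟩
  · intro a b _
    have := (hφ (a.mulConj b)).1
    simp only [h', Idx.mulConj, add_right_comm _ (1 : ℕ), add_right_comm _ (1 : ℤ)] at this ⊢
    exact this
  · intro a b _
    have := (hφ (a.mulConj b)).2.1
    simp only [h', Idx.mulConj, add_right_comm _ (1 : ℕ), add_right_comm _ (1 : ℤ)] at this ⊢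
    exact this
  · intro a b _
    have := (hφ (a.mulConj b)).2.2.1
    simp only [h', Idx.mulConj, add_right_comm _ (1 : ℕ), add_right_comm _ (1 : ℤ)] at this ⊢
    exact this
  · intro a b _
    have := (hφ (a.mulConj b)).2.2.2
    simp only [h', Idx.mulConj, add_right_comm _ (1 : ℕ), add_right_comm _ (1 : ℤ)] at this ⊢
    exact this
  all_goals
    intro a b p q hs _
    simp only [h', Idx.mulConj, hs]

lemma shiftRelations_of_linearConditions
    (h : LinearConditions (fun _ => True) fun a b => ip (H a) (H b)) : ShiftRelations H := by
  obtain ⟨h1, h2, h3, h4, -⟩ := h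
  -- a combination of the vectors `H b` which is orthogonal to all of them vanishes
  have key : ∀ (a₁ a₂ a₃ : Idx) (c : ℂ),
      (∀ b, ip (H a₁) (H b) + c * ip (H a₂) (H b) = ip (H a₃) (H b)) →
      H a₁ + c • H a₂ = H a₃ := by
    intro a₁ a₂ a₃ c hb
    have h0 : ∀ b, inner ℂ (H b) (H a₁ + c • H a₂ - H a₃) = 0 := fun b => by
      have := hb b
      simp only [ip] at this
      rw [inner_sub_right, inner_add_right, inner_smul_right, this, sub_self]
    rw [← sub_eq_zero, ← inner_self_eq_zero (𝕜 := ℂ)]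
    nth_rw 1 [inner_sub_left]
    rw [inner_add_left, inner_smul_left, h0, h0, h0]
    simp
  intro a
  refine ⟨key _ _ _ _ fun b => h1 a b trivial, ?_, key _ _ _ _ fun b => h3 a b trivial, ?_⟩
  · rw [sub_eq_add_neg, ← neg_smul]
    exact key _ _ _ _ fun b => by rw [neg_mul, ← sub_eq_add_neg]; exact h2 a b trivial
  · rw [sub_eq_add_neg, ← neg_smul]
    exact key _ _ _ _ fun b => by rw [neg_mul, ← sub_eq_add_neg]; exact h4 a b trivial

lemma hasGramFunction_of_linearConditions
    (h : LinearConditions (fun _ => True) fun a b => ip (H a) (H b)) :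
    HasGramFunction H fun a => ip (H a) (H ⟨0, 0, 0, 0, 0, 0⟩) := by
  obtain ⟨-, -, -, -, h1, h2, h3, h4, h5, h6⟩ := h
  rintro ⟨m, k, l, n, r, t⟩ ⟨m', k', l', n', r', t'⟩
  have e1 := h1 ⟨m, k, l, n, r, t⟩ ⟨m', k', l', n', r', t'⟩ (m + m') 0 (add_zero _).symm trivial
  have e2 := h2 ⟨m + m', k, l, n, r, t⟩ ⟨0, k', l', n', r', t'⟩ (k + l') 0 (add_zero _).symm trivial
  have e3 := h3 ⟨m + m', k + l', l, n, r, t⟩ ⟨0, k', 0, n', r', t'⟩ (l + k') 0 (add_zero _).symm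
    trivial
  have e4 := h4 ⟨m + m', k + l', l + k', n, r, t⟩ ⟨0, 0, 0, n', r', t'⟩ (n + n') 0
    (add_zero _).symm trivial
  have e5 := h5 ⟨m + m', k + l', l + k', n + n', r, t⟩ ⟨0, 0, 0, 0, r', t'⟩ (r + t') 0
    (add_zero _).symm trivial
  have e6 := h6 ⟨m + m', k + l', l + k', n + n', r + t', t⟩ ⟨0, 0, 0, 0, r', 0⟩ (t + r') 0
    (add_zero _).symm trivial
  exact e1.trans (e2.trans (e3.trans (e4.trans (e5.trans e6))))

end Conditions

section Solutions

variable {s : ℕ → ℕ → ℂ} {μ : Measure (ℝ × ℝ)}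

/-- The integrals of `x₁ᵐ x₂ⁿ (1 + x₁²)^{N₁} (1 + x₂²)^{N₂}` are determined by the moments. -/
lemma exists_integral_weighted_eq (s : ℕ → ℕ → ℂ) (N₁ N₂ m n : ℕ) :
    ∃ v : ℂ, ∀ μ : Measure (ℝ × ℝ), Solves s μ →
      Integrable (fun x : ℝ × ℝ => (x.1 : ℂ) ^ m * (x.2 : ℂ) ^ n *
        ((1 + (x.1 : ℂ) ^ 2) ^ N₁ * (1 + (x.2 : ℂ) ^ 2) ^ N₂)) μ ∧
      ∫ x : ℝ × ℝ, (x.1 : ℂ) ^ m * (x.2 : ℂ) ^ n *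
        ((1 + (x.1 : ℂ) ^ 2) ^ N₁ * (1 + (x.2 : ℂ) ^ 2) ^ N₂) ∂μ = v := by
  induction N₁ generalizing m with
  | zero =>
    induction N₂ generalizing n with
    | zero => exact ⟨s m n, fun μ hμ => by simpa using hμ m n⟩
    | succ N₂ ih =>
      obtain ⟨v, hv⟩ := ih n
      obtain ⟨v', hv'⟩ := ih (n + 2)
      refine ⟨v + v', fun μ hμ => ?_⟩
      have h1 : (fun x : ℝ × ℝ => (x.1 : ℂ) ^ m * (x.2 : ℂ) ^ n *
          ((1 + (x.1 : ℂ) ^ 2) ^ 0 * (1 + (x.2 : ℂ) ^ 2) ^ (N₂ + 1))) = fun x : ℝ × ℝ =>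
          (x.1 : ℂ) ^ m * (x.2 : ℂ) ^ n * ((1 + (x.1 : ℂ) ^ 2) ^ 0 * (1 + (x.2 : ℂ) ^ 2) ^ N₂) +
          (x.1 : ℂ) ^ m * (x.2 : ℂ) ^ (n + 2) *
            ((1 + (x.1 : ℂ) ^ 2) ^ 0 * (1 + (x.2 : ℂ) ^ 2) ^ N₂) := by
        funext x; ring
      rw [h1, integral_add (hv μ hμ).1 (hv' μ hμ).1, (hv μ hμ).2, (hv' μ hμ).2]
      exact ⟨(hv μ hμ).1.add (hv' μ hμ).1, rfl⟩
  | succ N₁ ih =>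
    obtain ⟨v, hv⟩ := ih m
    obtain ⟨v', hv'⟩ := ih (m + 2)
    refine ⟨v + v', fun μ hμ => ?_⟩
    have h1 : (fun x : ℝ × ℝ => (x.1 : ℂ) ^ m * (x.2 : ℂ) ^ n *
        ((1 + (x.1 : ℂ) ^ 2) ^ (N₁ + 1) * (1 + (x.2 : ℂ) ^ 2) ^ N₂)) = fun x : ℝ × ℝ =>
        (x.1 : ℂ) ^ m * (x.2 : ℂ) ^ n * ((1 + (x.1 : ℂ) ^ 2) ^ N₁ * (1 + (x.2 : ℂ) ^ 2) ^ N₂) +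
        (x.1 : ℂ) ^ (m + 2) * (x.2 : ℂ) ^ n *
          ((1 + (x.1 : ℂ) ^ 2) ^ N₁ * (1 + (x.2 : ℂ) ^ 2) ^ N₂) := by
      funext x; ring
    rw [h1, integral_add (hv μ hμ).1 (hv' μ hμ).1, (hv μ hμ).2, (hv' μ hμ).2]
    exact ⟨(hv μ hμ).1.add (hv' μ hμ).1, rfl⟩

lemma zpow_le_pow_natAbs {u q : ℝ} (h1 : 1 ≤ u) (h2 : u ≤ q) (k : ℤ) : u ^ k ≤ q ^ k.natAbs :=
  calc u ^ k ≤ u ^ (k.natAbs : ℤ) := zpow_le_zpow_right₀ h1 (by omega)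
    _ = u ^ k.natAbs := zpow_natCast _ _
    _ ≤ q ^ k.natAbs := pow_le_pow_left₀ (by linarith) h2 _

lemma norm_factor_le (x : ℝ) (m : ℕ) (k l : ℤ) :
    ‖(x : ℂ) ^ m * ((x : ℂ) + Complex.I) ^ k * ((x : ℂ) - Complex.I) ^ l‖ ≤
      (1 + x ^ 2) ^ (m + k.natAbs + l.natAbs) := by
  have hq : ∀ u : ℝ, 0 ≤ u → u ^ 2 = 1 + x ^ 2 → 1 ≤ u ∧ u ≤ 1 + x ^ 2 := by
    intro u hu h
    have h1 : 1 ≤ u := by nlinarith [sq_nonneg x]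
    exact ⟨h1, by nlinarith⟩
  have hp := hq ‖(x : ℂ) + Complex.I‖ (norm_nonneg _) (by
    rw [← Complex.normSq_eq_norm_sq, Complex.normSq_apply]; simp; ring)
  have hm := hq ‖(x : ℂ) - Complex.I‖ (norm_nonneg _) (by
    rw [← Complex.normSq_eq_norm_sq, Complex.normSq_apply]; simp; ring)
  have hx : ‖(x : ℂ)‖ ≤ 1 + x ^ 2 := by
    rw [Complex.norm_real, Real.norm_eq_abs, abs_le]
    constructor <;> nlinarith [sq_nonneg (x + 1), sq_nonneg (x - 1)]
  rw [norm_mul, norm_mul, norm_pow, norm_zpow, norm_zpow, pow_add, pow_add]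
  have h0 : (0 : ℝ) ≤ 1 + x ^ 2 := by positivity
  gcongr
  · exact zpow_le_pow_natAbs hp.1 hp.2 k
  · exact zpow_le_pow_natAbs hm.1 hm.2 l

lemma norm_extMonomial_le (a : Idx) (x : ℝ × ℝ) :
    ‖extMonomial a x‖ ≤ (1 + x.1 ^ 2) ^ (a.m + a.k.natAbs + a.l.natAbs) *
      (1 + x.2 ^ 2) ^ (a.n + a.r.natAbs + a.t.natAbs) := by
  rw [extMonomial, norm_mul]
  have h0 : (0 : ℝ) ≤ 1 + x.1 ^ 2 := by positivity
  gcongr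
  · exact norm_factor_le _ _ _ _
  · exact norm_factor_le _ _ _ _

/-- Every solution of the moment problem integrates all extended monomials, with a bound which
does not depend on the solution. -/
lemma exists_integral_norm_extMonomial_le (s : ℕ → ℕ → ℂ) (a : Idx) :
    ∃ C : ℝ, ∀ μ : Measure (ℝ × ℝ), Solves s μ →
      Integrable (extMonomial a) μ ∧ ∫ x, ‖extMonomial a x‖ ∂μ ≤ C := by
  obtain ⟨v, hv⟩ := exists_integral_weighted_eq s (a.m + a.k.natAbs + a.l.natAbs)
    (a.n + a.r.natAbs + a.t.natAbs) 0 0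
  refine ⟨v.re, fun μ hμ => ?_⟩
  obtain ⟨h1, h2⟩ := hv μ hμ
  have h3 : (fun x : ℝ × ℝ => (x.1 : ℂ) ^ 0 * (x.2 : ℂ) ^ 0 *
      ((1 + (x.1 : ℂ) ^ 2) ^ (a.m + a.k.natAbs + a.l.natAbs) *
        (1 + (x.2 : ℂ) ^ 2) ^ (a.n + a.r.natAbs + a.t.natAbs))) = fun x : ℝ × ℝ =>
      (((1 + x.1 ^ 2) ^ (a.m + a.k.natAbs + a.l.natAbs) *
        (1 + x.2 ^ 2) ^ (a.n + a.r.natAbs + a.t.natAbs) : ℝ) : ℂ) := by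
    funext x; push_cast; ring
  rw [h3] at h1 h2
  have h4 : Integrable (fun x : ℝ × ℝ => (1 + x.1 ^ 2) ^ (a.m + a.k.natAbs + a.l.natAbs) *
        (1 + x.2 ^ 2) ^ (a.n + a.r.natAbs + a.t.natAbs)) μ := by
    exact h1.re
  have h5 : Integrable (extMonomial a) μ :=
    h4.mono' (continuous_extMonomial a).aestronglyMeasurable
      (.of_forall fun x => norm_extMonomial_le a x)
  refine ⟨h5, ?_⟩
  rw [integral_complex_ofReal] at h2
  rw [← h2, Complex.ofReal_re]
  exact integral_mono h5.norm h4 fun x => norm_extMonomial_le a x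

lemma Solves.integrable_extMonomial (hμ : Solves s μ) (a : Idx) :
    Integrable (extMonomial a) μ :=
  let ⟨_, h⟩ := exists_integral_norm_extMonomial_le s a
  (h μ hμ).1

lemma norm_extMonomial_sq (a : Idx) (x : ℝ × ℝ) :
    ‖extMonomial a x‖ ^ 2 = ‖extMonomial (a.mulConj a) x‖ := by
  rw [extMonomial_mulConj, norm_mul, RCLike.norm_conj, sq]

lemma exists_isMomentBound (s : ℕ → ℕ → ℂ) (w : ℕ ≃ Idx.Omega') :
    ∃ M : ℕ → ℝ, IsMomentBound s w M := by
  choose C hC using exists_integral_norm_extMonomial_le s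
  refine ⟨fun j => C ((w j : Idx).mulConj (w j)), fun μ hμ j => ?_⟩
  simp_rw [norm_extMonomial_sq]
  exact (hC _ μ hμ).2

lemma Solves.memLp_extMonomial (hμ : Solves s μ) (a : Idx) : MemLp (extMonomial a) 2 μ := by
  rw [memLp_two_iff_integrable_sq_norm (continuous_extMonomial a).aestronglyMeasurable]
  simp_rw [norm_extMonomial_sq]
  exact (hμ.integrable_extMonomial _).norm

lemma Solves.inner_toLp (hμ : Solves s μ) (a b : Idx) :
    inner ℂ ((hμ.memLp_extMonomial b).toLp) ((hμ.memLp_extMonomial a).toLp) =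
      ∫ x, extMonomial (a.mulConj b) x ∂μ := by
  rw [L2.inner_def]
  refine integral_congr_ae ?_
  filter_upwards [(hμ.memLp_extMonomial a).coeFn_toLp, (hμ.memLp_extMonomial b).coeFn_toLp]
    with x h1 h2
  rw [h1, h2, extMonomial_mulConj, RCLike.inner_apply]

lemma Solves.solvesExt (hμ : Solves s μ) :
    SolvesExt (fun a => ∫ x, extMonomial a x ∂μ) μ :=
  fun a => ⟨hμ.integrable_extMonomial a, rfl⟩

lemma SolvesExt.scalarShiftRelations {φ : Idx → ℂ} (hμ : SolvesExt φ μ) :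
    ScalarShiftRelations φ := by
  have hadd : ∀ (a b c : Idx) (z : ℂ),
      (∀ x, extMonomial a x + z * extMonomial b x = extMonomial c x) →
      φ a + z * φ b = φ c := by
    intro a b c z h
    rw [← (hμ a).2, ← (hμ b).2, ← (hμ c).2, ← integral_const_mul,
      ← integral_add (hμ a).1 ((hμ b).1.const_mul z)]
    simp_rw [h]
  intro a
  refine ⟨hadd _ _ _ _ fun x => (extMonomial_shift a x).1, ?_,
    hadd _ _ _ _ fun x => (extMonomial_shift a x).2.2.1, ?_⟩
  · rw [sub_eq_add_neg, ← neg_mul]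
    exact hadd _ _ _ _ fun x => by
      rw [neg_mul, ← sub_eq_add_neg]; exact (extMonomial_shift a x).2.1
  · rw [sub_eq_add_neg, ← neg_mul]
    exact hadd _ _ _ _ fun x => by
      rw [neg_mul, ← sub_eq_add_neg]; exact (extMonomial_shift a x).2.2.2

end Solutions

/-! ### The steps of the algorithm -/

section Algorithm

variable {𝓗 : Type*} [NormedAddCommGroup 𝓗] [InnerProductSpace ℂ 𝓗]
  {s : ℕ → ℕ → ℂ} (S : ModelSpace s 𝓗) (w : ℕ ≃ Idx.Omega')

namespace ModelSpace

lemma h_mem (m n : ℕ) : S.h m n ∈ S.H0 := by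
  rw [← S.span_h]
  exact Submodule.le_topologicalClosure _ (Submodule.subset_span ⟨(m, n), rfl⟩)

lemma inner_e_of_mem_H0 {v : 𝓗} (hv : v ∈ S.H0) (j : ℕ) : inner ℂ (S.e j) v = 0 :=
  S.orthogonal v hv j

variable {S}

lemma partialSum_mono {J K : Set ℕ} (h : J ⊆ K) : S.partialSum J ≤ S.partialSum K :=
  sup_le_sup_left (Submodule.span_mono (Set.image_mono h)) _

lemma H0_le_partialSum (J : Set ℕ) : S.H0 ≤ S.partialSum J := le_sup_left

lemma e_mem_partialSum {J : Set ℕ} {j : ℕ} (hj : j ∈ J) : S.e j ∈ S.partialSum J :=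
  Submodule.mem_sup_right (Submodule.subset_span ⟨j, hj, rfl⟩)

lemma inner_e_of_mem_partialSum {J : Set ℕ} {v : 𝓗} (hv : v ∈ S.partialSum J) {r : ℕ}
    (hr : r ∉ J) : inner ℂ (S.e r) v = 0 := by
  obtain ⟨u, hu, z, hz, rfl⟩ := Submodule.mem_sup.1 hv
  rw [inner_add_right, S.inner_e_of_mem_H0 hu, zero_add]
  refine Submodule.span_induction (p := fun z _ => inner ℂ (S.e r) z = 0) ?_ ?_ ?_ ?_ hz
  · rintro _ ⟨j, hj, rfl⟩
    exact S.orthonormal_e.2 fun h => hr (h ▸ hj)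
  · simp
  · intro x y _ _ hx hy
    rw [inner_add_right, hx, hy, add_zero]
  · intro a x _ hx
    rw [inner_smul_right, hx, mul_zero]

lemma inner_e_of_mem_partialSum' {J : Set ℕ} {v : 𝓗} (hv : v ∈ S.partialSum J) {r : ℕ}
    (hr : r ∉ J) : inner ℂ v (S.e r) = 0 := by
  rw [← inner_conj_symm, inner_e_of_mem_partialSum hv hr, map_zero]

end ModelSpace

section Assemble

variable {S w}

lemma assemble_w (f : ℕ → 𝓗) (j : ℕ) : assemble S w f (w j) = f j := by
  rw [assemble, dif_pos (w j).2]
  simp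

lemma assemble_of_mem_omega0 (f : ℕ → 𝓗) {a : Idx} (ha : a ∈ Idx.Omega0) :
    assemble S w f a = S.h a.m a.n := by
  rw [assemble, dif_neg]
  exact fun h => h ha

lemma mem_omega0_or_eq_w (w : ℕ ≃ Idx.Omega') (a : Idx) : a ∈ Idx.Omega0 ∨ ∃ j, a = w j := by
  by_cases h : a ∈ Idx.Omega0
  · exact .inl h
  · exact .inr ⟨w.symm ⟨a, h⟩, by simp⟩

lemma w_injective {i j : ℕ} (h : (w i : Idx) = w j) : i = j :=
  w.injective (Subtype.ext h)

lemma eq_omega0_idx {a : Idx} (ha : a ∈ Idx.Omega0) : a = ⟨a.m, 0, 0, a.n, 0, 0⟩ := by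
  obtain ⟨h1, h2, h3, h4⟩ := ha
  ext <;> simp [h1, h2, h3, h4]

lemma knownVectors_eq_assemble {r : ℕ} {prev : Fin r → 𝓗} {f : ℕ → 𝓗}
    (hprev : prev = fun j : Fin r => f j) {a : Idx} (ha : a ∈ Idx.Omega0 ∨ ∃ j < r, a = w j) :
    knownVectors S w r prev a = assemble S w f a := by
  rcases ha with ha | ⟨j, hj, rfl⟩
  · rw [knownVectors, assemble_of_mem_omega0 _ ha, assemble_of_mem_omega0 _ ha]
  · rw [knownVectors, assemble_w, assemble_w, dif_pos hj, hprev]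

lemma assemble_mem_partialSum {r : ℕ} {f : ℕ → 𝓗}
    (hf : ∀ j < r, f j ∈ S.partialSum {i | i ≤ j}) {a : Idx}
    (ha : a ∈ Idx.Omega0 ∨ ∃ j < r, a = w j) :
    assemble S w f a ∈ S.partialSum {i | i < r} := by
  rcases ha with ha | ⟨j, hj, rfl⟩
  · rw [assemble_of_mem_omega0 _ ha]
    exact ModelSpace.H0_le_partialSum _ (S.h_mem _ _)
  · rw [assemble_w]
    exact ModelSpace.partialSum_mono (fun i (hi : i ≤ j) => hi.trans_lt hj) (hf j hj)

end Assemble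

/-- The conditions checked at the outset are implied by the Gram matrix of the vectors
`h_{m,n}`. -/
lemma initialCheck : InitialCheck S := by
  refine ⟨?_, ?_, ?_, ?_, ?_, ?_, ?_, ?_, ?_, ?_⟩
  · intro a b h
    have h1 : a.k = 0 := (h (by simp : a ∈ _)).1
    have h2 : a.k + 1 = 0 := (h (by simp : ({a with k := a.k + 1} : Idx) ∈ _)).1
    omega
  · intro a b h
    have h1 : a.l = 0 := (h (by simp : a ∈ _)).2.1
    have h2 : a.l + 1 = 0 := (h (by simp : ({a with l := a.l + 1} : Idx) ∈ _)).2.1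
    omega
  · intro a b h
    have h1 : a.r = 0 := (h (by simp : a ∈ _)).2.2.1
    have h2 : a.r + 1 = 0 := (h (by simp : ({a with r := a.r + 1} : Idx) ∈ _)).2.2.1
    omega
  · intro a b h
    have h1 : a.t = 0 := (h (by simp : a ∈ _)).2.2.2
    have h2 : a.t + 1 = 0 := (h (by simp : ({a with t := a.t + 1} : Idx) ∈ _)).2.2.2
    omega
  · intro a b p q hs _
    simp only [S.gram, hs]
  · intro a b p q _ _; rfl
  · intro a b p q _ _; rfl
  · intro a b p q hs _
    simp only [S.gram, hs]
  · intro a b p q _ _; rfl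
  · intro a b p q _ _; rfl

section Candidates

variable {S} {ι : Type*} {g : HilbertBasis ι ℂ S.H0} {r : ℕ} {A : Finset (Fin r)}

lemma lowerPart_eq (c : Candidate 𝓗 ι r A) :
    lowerPart S g c = (g.repr.symm c.α : 𝓗) + ∑ j : A, c.β j • S.e (j : Fin r) := by
  have h := (g.hasSum_repr_symm c.α).mapL S.H0.subtypeL
  simp only [map_smul, Submodule.subtypeL_apply] at h
  rw [lowerPart, h.tsum_eq]

lemma lowerPart_mem (c : Candidate 𝓗 ι r A) :
    lowerPart S g c ∈ S.partialSum {i | ∃ h : i < r, (⟨i, h⟩ : Fin r) ∈ A} := by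
  rw [lowerPart_eq]
  refine add_mem (ModelSpace.H0_le_partialSum _ (Subtype.coe_prop _))
    (Submodule.sum_mem _ fun j _ => Submodule.smul_mem _ _ ?_)
  exact ModelSpace.e_mem_partialSum ⟨j.1.2, j.2⟩

lemma lowerPart_mem_lt (c : Candidate 𝓗 ι r A) : lowerPart S g c ∈ S.partialSum {i | i < r} :=
  ModelSpace.partialSum_mono (fun _ hi => hi.1) (lowerPart_mem c)

lemma norm_lowerPart_sq (c : Candidate 𝓗 ι r A) : ‖lowerPart S g c‖ ^ 2 = lowerNormSq c := by
  have h1 : inner ℂ (g.repr.symm c.α : 𝓗) (∑ j : A, c.β j • S.e (j : Fin r)) = 0 := by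
    rw [inner_sum]
    refine Finset.sum_eq_zero fun j _ => ?_
    rw [inner_smul_right, ← inner_conj_symm, S.inner_e_of_mem_H0 (Subtype.coe_prop _), map_zero,
      mul_zero]
  have h2 := norm_add_sq_eq_norm_sq_add_norm_sq_of_inner_eq_zero _ _ h1
  have h3 : ‖(g.repr.symm c.α : 𝓗)‖ ^ 2 = ∑' n, ‖c.α n‖ ^ 2 := by
    change ‖g.repr.symm c.α‖ ^ 2 = _
    rw [LinearIsometryEquiv.norm_map]
    have := lp.norm_rpow_eq_tsum (p := 2) (by norm_num) c.α
    simpa using this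
  have horth : Orthonormal ℂ fun j : A => S.e (j : Fin r) :=
    S.orthonormal_e.comp _ fun i j h => Subtype.ext (Fin.ext h)
  have h4 : ‖∑ j : A, c.β j • S.e (j : Fin r)‖ ^ 2 = ∑ j : A, ‖c.β j‖ ^ 2 := by
    have h5 := horth.inner_sum c.β c.β Finset.univ
    rw [inner_self_eq_norm_sq_to_K] at h5
    simp only [RCLike.conj_mul] at h5
    exact_mod_cast h5
  rw [lowerPart_eq, lowerNormSq, ← h3, ← h4, sq, sq, sq, h2]

lemma inner_e_newVector (c : Candidate 𝓗 ι r A) :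
    inner ℂ (S.e r) (newVector S g c) = ((√(c.d - lowerNormSq c) : ℝ) : ℂ) := by
  rw [newVector, inner_add_right, ModelSpace.inner_e_of_mem_partialSum (lowerPart_mem_lt c)
    (lt_irrefl r), zero_add, inner_smul_right, inner_self_eq_norm_sq_to_K, S.orthonormal_e.1]
  simp

lemma norm_newVector_sq {c : Candidate 𝓗 ι r A} (hc : lowerNormSq c ≤ c.d) :
    ‖newVector S g c‖ ^ 2 = c.d := by
  have h1 : inner ℂ (lowerPart S g c) (((√(c.d - lowerNormSq c) : ℝ) : ℂ) • S.e r) = 0 := by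
    rw [inner_smul_right, ModelSpace.inner_e_of_mem_partialSum' (lowerPart_mem_lt c)
      (lt_irrefl r), mul_zero]
  have h2 := norm_add_sq_eq_norm_sq_add_norm_sq_of_inner_eq_zero _ _ h1
  rw [newVector, sq, h2, ← sq, ← sq, norm_lowerPart_sq, norm_smul, S.orthonormal_e.1,
    mul_one, Complex.norm_real, Real.norm_eq_abs, sq_abs, Real.sq_sqrt (sub_nonneg.2 hc)]
  ring

lemma newVector_mem (c : Candidate 𝓗 ι r A) : newVector S g c ∈ S.partialSum {i | i ≤ r} :=
  add_mem (ModelSpace.partialSum_mono (fun _ (hi : _ < r) => hi.le) (lowerPart_mem_lt c))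
    (Submodule.smul_mem _ _ (ModelSpace.e_mem_partialSum (le_refl r)))

variable {w}

/-- The scalar products used in the linear system of a step are the actual ones of the vectors
which the step produces. -/
lemma stepGram_eq {c : Candidate 𝓗 ι r A} {f : ℕ → 𝓗} (hprev : c.prev = fun j : Fin r => f j)
    (hnew : newVector S g c = f r) (hc : lowerNormSq c ≤ c.d)
    (hf : ∀ j < r, f j ∈ S.partialSum {i | i ≤ j}) {a b : Idx}
    (ha : a ∈ Idx.Omega0 ∪ {a | ∃ j ≤ r, a = w j}) (hb : b ∈ Idx.Omega0 ∪ {a | ∃ j ≤ r, a = w j}) :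
    stepGram S w g c a b = ip (assemble S w f a) (assemble S w f b) := by
  have hlt : ∀ a ∈ Idx.Omega0 ∪ {a | ∃ j ≤ r, a = w j}, a ≠ w r →
      a ∈ Idx.Omega0 ∨ ∃ j < r, a = w j := by
    rintro a (ha | ⟨j, hj, rfl⟩) hne
    · exact .inl ha
    · exact .inr ⟨j, lt_of_le_of_ne hj fun h => hne (by rw [h]), rfl⟩
  have hdrop : ∀ v ∈ S.partialSum {i | i < r}, inner ℂ v (f r) = inner ℂ v (lowerPart S g c) := by
    intro v hv
    rw [← hnew, newVector, inner_add_right, inner_smul_right,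
      ModelSpace.inner_e_of_mem_partialSum' hv (lt_irrefl r), mul_zero, add_zero]
  rw [stepGram]
  split_ifs with h1 h2 h2
  · subst h1 h2
    rw [assemble_w, ip, inner_self_eq_norm_sq_to_K, ← hnew, ← norm_newVector_sq (g := g) hc]
    push_cast
    rfl
  · subst h1
    rw [assemble_w, knownVectors_eq_assemble hprev (hlt b hb h2), ip, ip,
      hdrop _ (assemble_mem_partialSum hf (hlt b hb h2))]
  · subst h2
    rw [assemble_w, knownVectors_eq_assemble hprev (hlt a ha h1), ip, ip, ← inner_conj_symm,
      ← hdrop _ (assemble_mem_partialSum hf (hlt a ha h1)), inner_conj_symm]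
  · rw [knownVectors_eq_assemble hprev (hlt a ha h1), knownVectors_eq_assemble hprev (hlt b hb h2)]

end Candidates

section Steps

variable {ι : Type*} (g : HilbertBasis ι ℂ S.H0) (M : ℕ → ℝ)

/-- The vector `f r` may be chosen in step `r` of the algorithm with the coefficients `β j`,
`j ∈ A`, provided that `f 0, …, f (r - 1)` were chosen before. -/
def IsStepOutput (f : ℕ → 𝓗) (r : ℕ) (A : Finset (Fin r)) : Prop :=
  ∃ c : Candidate 𝓗 ι r A, c.prev = (fun j : Fin r => f j) ∧ newVector S g c = f r ∧
    LinearConditions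
      (fun T => (w r : Idx) ∈ T ∧ T ⊆ Idx.Omega0 ∪ {a | ∃ j ≤ r, a = w j})
      (stepGram S w g c) ∧ lowerNormSq c ≤ c.d ∧ c.d ≤ M r

variable {S w g M}

lemma mem_stepTuples_iff {f : ℕ → 𝓗} {r : ℕ} {Γ : Set (Fin r → 𝓗)} {A : Finset (Fin r)} :
    (fun j : Fin (r + 1) => f j) ∈ stepTuples S w g M r Γ A ↔
      (fun j : Fin r => f j) ∈ Γ ∧ IsStepOutput S w g M f r A := by
  constructor
  · rintro ⟨c, ⟨⟨h1, h2⟩, h3, h4⟩, h5⟩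
    have hprev : c.prev = fun j : Fin r => f j := by
      funext j
      have := congrFun h5 j.castSucc
      simpa using this
    have hnew : newVector S g c = f r := by
      have := congrFun h5 (Fin.last r)
      simpa using this
    exact ⟨hprev ▸ h1, c, hprev, hnew, h2, h3, h4⟩
  · rintro ⟨h1, c, hprev, hnew, h2, h3, h4⟩
    refine ⟨c, ⟨⟨hprev ▸ h1, h2⟩, h3, h4⟩, ?_⟩
    funext j
    refine Fin.lastCases ?_ (fun j => ?_) j
    · simpa using hnew
    · simp [hprev]

namespace IsStepOutput

variable {f : ℕ → 𝓗} {r : ℕ} {A : Finset (Fin r)}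

lemma mem (h : IsStepOutput S w g M f r A) : f r ∈ S.partialSum {i | i ≤ r} := by
  obtain ⟨c, -, hnew, -⟩ := h
  exact hnew ▸ newVector_mem c

lemma ip_nonneg (h : IsStepOutput S w g M f r A) : 0 ≤ ip (f r) (S.e r) := by
  obtain ⟨c, -, hnew, -⟩ := h
  rw [← hnew, ip, inner_e_newVector]
  exact Complex.zero_le_real.2 (Real.sqrt_nonneg _)

lemma norm_le (h : IsStepOutput S w g M f r A) : ‖f r‖ ≤ √(M r) := by
  obtain ⟨c, -, hnew, -, h3, h4⟩ := h
  refine Real.le_sqrt_of_sq_le ?_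
  rw [← hnew, norm_newVector_sq h3]
  exact h4

/-- The vector `e r` occurs in `f r` only if its coefficient is positive. -/
lemma mem_of_subset (h : IsStepOutput S w g M f r A) {Λ : Set ℕ}
    (hA : ∀ j ∈ A, (j : ℕ) ∈ Λ) (hr : 0 < ip (f r) (S.e r) → r ∈ Λ) :
    f r ∈ S.partialSum {j | j ∈ Λ ∧ j ≤ r} := by
  have hnn := h.ip_nonneg
  obtain ⟨c, -, hnew, -⟩ := h
  have hlow : lowerPart S g c ∈ S.partialSum {j | j ∈ Λ ∧ j ≤ r} :=
    ModelSpace.partialSum_mono (K := {j | j ∈ Λ ∧ j ≤ r}) (fun _ hi => ⟨hA _ hi.2, hi.1.le⟩) (lowerPart_mem c)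
  have hip : ip (f r) (S.e r) = ((√(c.d - lowerNormSq c) : ℝ) : ℂ) := by
    rw [← hnew, ip, inner_e_newVector]
  rcases hnn.eq_or_lt with h0 | h0
  · rw [← hnew, newVector, ← hip, ← h0, zero_smul, add_zero]
    exact hlow
  · rw [← hnew]
    exact add_mem hlow (Submodule.smul_mem _ _ (ModelSpace.e_mem_partialSum
      (show r ∈ {j | j ∈ Λ ∧ j ≤ r} from ⟨hr h0, le_refl r⟩)))

end IsStepOutput

lemma mem_setG_iff {f : ℕ → 𝓗} :
    f ∈ setG S w g M ↔ ∀ r, IsStepOutput S w g M f r Finset.univ := by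
  constructor
  · intro h r
    exact (mem_stepTuples_iff.1 (Set.mem_iInter.1 h r).1).2
  · intro h
    have htup : ∀ r, (fun j : Fin r => f j) ∈ tuplesG S w g M r := by
      intro r
      induction r with
      | zero => trivial
      | succ r ih => exact mem_stepTuples_iff.2 ⟨ih, h r⟩
    exact Set.mem_iInter.2 fun r => ⟨htup _, fun j _ => (h j).norm_le⟩

lemma mem_setGmod_iff {f : ℕ → 𝓗} :
    f ∈ setGmod S w g M ↔ ∀ r, ∃ σ : Fin r → Bool,
      (fun j : Fin r => f j) ∈ patternTuples S r σ ∧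
      IsStepOutput S w g M f r (Finset.univ.filter fun j => σ j = true) := by
  constructor
  · intro h r
    obtain ⟨σ, hσ⟩ := Set.mem_iUnion.1 (Set.mem_iInter.1 h r).1
    have := mem_stepTuples_iff.1 hσ
    exact ⟨σ, this.1.2, this.2⟩
  · intro h
    have htup : ∀ r, (fun j : Fin r => f j) ∈ tuplesGmod S w g M r := by
      intro r
      induction r with
      | zero => trivial
      | succ r ih =>
        obtain ⟨σ, h1, h2⟩ := h r
        exact Set.mem_iUnion.2 ⟨σ, mem_stepTuples_iff.2 ⟨⟨ih, h1⟩, h2⟩⟩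
    refine Set.mem_iInter.2 fun r => ⟨htup _, fun j _ => ?_⟩
    obtain ⟨σ, -, h2⟩ := h j
    exact h2.norm_le

/-- A sequence produced by the algorithm satisfies all the linear conditions: each of them is
imposed in the step which finds the last of the vectors occurring in it. -/
theorem linearConditions_of_isStepOutput {f : ℕ → 𝓗}
    (h : ∀ r, ∃ A, IsStepOutput S w g M f r A) :
    LinearConditions (fun _ => True) fun a b => ip (assemble S w f a) (assemble S w f b) := by
  refine linearConditions_of_local fun T hT _ => ?_
  have hfin : {j | (w j : Idx) ∈ T}.Finite :=
    hT.preimage fun i _ j _ hij => w_injective hij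
  by_cases hne : {j | (w j : Idx) ∈ T}.Nonempty
  · obtain ⟨r, hr, hmax⟩ := hfin.exists_maximalFor id _ hne
    obtain ⟨A, c, hprev, hnew, hlin, hc, -⟩ := h r
    have hsub : T ⊆ Idx.Omega0 ∪ {a | ∃ j ≤ r, a = w j} := by
      intro a ha
      rcases mem_omega0_or_eq_w w a with h0 | ⟨j, rfl⟩
      · exact .inl h0
      · exact .inr ⟨j, (le_total j r).elim id fun hle => hmax ha hle, rfl⟩
    refine ⟨_, _, ⟨hr, hsub⟩, hlin, fun a ha b hb => ?_⟩
    refine (stepGram_eq hprev hnew hc (fun j _ => ?_) (hsub ha) (hsub hb)).symm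
    obtain ⟨A', hA'⟩ := h j
    exact hA'.mem
  · have hsub : T ⊆ Idx.Omega0 := by
      intro a ha
      rcases mem_omega0_or_eq_w w a with h0 | ⟨j, rfl⟩
      · exact h0
      · exact absurd ⟨j, ha⟩ hne
    refine ⟨_, _, hsub, initialCheck S, fun a ha b hb => ?_⟩
    rw [assemble_of_mem_omega0 _ (hsub ha), assemble_of_mem_omega0 _ (hsub hb)]

/-- A triangular sequence which satisfies all linear conditions can be found by the algorithm. -/
lemma isStepOutput_of_triangular {f p : ℕ → 𝓗} {β : ℕ → ℕ → ℂ} (hp : ∀ r, p r ∈ S.H0)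
    (hf : ∀ r, f r = p r + ∑ j ∈ Finset.range (r + 1), β r j • S.e j)
    (hβ : ∀ r, 0 ≤ β r r)
    (hlin : LinearConditions (fun _ => True) fun a b => ip (assemble S w f a) (assemble S w f b))
    (hM : ∀ r, ‖f r‖ ^ 2 ≤ M r) {r : ℕ} {A : Finset (Fin r)}
    (hA : ∀ j : Fin r, j ∉ A → β r j = 0) : IsStepOutput S w g M f r A := by
  set c : Candidate 𝓗 ι r A :=
    { prev := fun j => f j
      α := g.repr ⟨p r, hp r⟩
      β := fun j => β r (j : Fin r)
      d := ‖f r‖ ^ 2 } with hcdef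
  have hlow : lowerPart S g c = p r + ∑ j ∈ Finset.range r, β r j • S.e j := by
    rw [lowerPart_eq]
    congr 1
    · simp [hcdef]
    · rw [Finset.sum_coe_sort A fun j : Fin r => β r j • S.e j,
        Finset.sum_range fun j => β r j • S.e j]
      refine Finset.sum_subset (Finset.subset_univ _) fun j _ hj => ?_
      rw [hA j hj, zero_smul]
  have hfr : f r = lowerPart S g c + β r r • S.e r := by
    rw [hlow, hf, Finset.sum_range_succ, add_assoc]
  have hort : inner ℂ (lowerPart S g c) (β r r • S.e r) = 0 := by
    rw [inner_smul_right, ModelSpace.inner_e_of_mem_partialSum' (lowerPart_mem_lt c)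
      (lt_irrefl r), mul_zero]
  have hd : c.d = lowerNormSq c + ‖β r r‖ ^ 2 := by
    have h2 := norm_add_sq_eq_norm_sq_add_norm_sq_of_inner_eq_zero _ _ hort
    rw [← hfr, norm_smul, S.orthonormal_e.1, mul_one, ← sq, ← sq, ← sq, norm_lowerPart_sq] at h2
    exact h2
  have hle : lowerNormSq c ≤ c.d := by rw [hd]; exact le_add_of_nonneg_right (sq_nonneg _)
  have hsqrt : ((√(c.d - lowerNormSq c) : ℝ) : ℂ) = β r r := by
    rw [hd, add_sub_cancel_left, Real.sqrt_sq (norm_nonneg _)]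
    exact Complex.norm_of_nonneg' (hβ r)
  have hnew : newVector S g c = f r := by rw [newVector, hsqrt, hfr]
  have hmem : ∀ j, f j ∈ S.partialSum {i | i ≤ j} := by
    intro j
    rw [hf]
    exact add_mem (ModelSpace.H0_le_partialSum _ (hp j)) (Submodule.sum_mem _ fun i hi =>
      Submodule.smul_mem _ _ (ModelSpace.e_mem_partialSum
        (Nat.lt_succ_iff.1 (Finset.mem_range.1 hi))))
  refine ⟨c, rfl, hnew, ?_, hle, hM r⟩
  refine linearConditions_of_local fun T _ hT => ⟨_, _, trivial, hlin, fun a ha b hb => ?_⟩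
  exact stepGram_eq rfl hnew hle (fun j _ => hmem j) (hT.2 ha) (hT.2 hb)

end Steps

end Algorithm

/-! ### Correspondence between sequences of vectors and measures -/

section Correspondence

variable {𝓗 : Type*} [NormedAddCommGroup 𝓗] [InnerProductSpace ℂ 𝓗]
  {s : ℕ → ℕ → ℂ} {S : ModelSpace s 𝓗} {w : ℕ ≃ Idx.Omega'}

lemma ModelSpace.inner_eq_zero_of_mem_H0 {v : 𝓗} (hv : ∀ m n, inner ℂ (S.h m n) v = 0) {u : 𝓗}
    (hu : u ∈ S.H0) : inner ℂ u v = 0 := by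
  rw [← S.span_h] at hu
  refine closure_minimal (t := {u : 𝓗 | inner ℂ u v = 0}) (fun u hu => ?_)
    (isClosed_eq (by fun_prop) continuous_const) hu
  refine Submodule.span_induction (p := fun u _ => inner ℂ u v = 0) ?_ ?_ ?_ ?_ hu
  · rintro _ ⟨p, rfl⟩; exact hv p.1 p.2
  · simp
  · intro x y _ _ hx hy
    rw [inner_add_left, hx, hy, add_zero]
  · intro a x _ hx
    rw [inner_smul_left, hx, mul_zero]

lemma ModelSpace.inner_eq_zero_of_mem_partialSum {v : 𝓗} {J : Set ℕ}
    (hv : ∀ m n, inner ℂ (S.h m n) v = 0) (he : ∀ j ∈ J, inner ℂ (S.e j) v = 0) {u : 𝓗}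
    (hu : u ∈ S.partialSum J) : inner ℂ u v = 0 := by
  obtain ⟨u, hu', z, hz, rfl⟩ := Submodule.mem_sup.1 hu
  rw [inner_add_left, inner_eq_zero_of_mem_H0 hv hu', zero_add]
  refine Submodule.span_induction (p := fun z _ => inner ℂ z v = 0) ?_ ?_ ?_ ?_ hz
  · rintro _ ⟨j, hj, rfl⟩; exact he j hj
  · simp
  · intro x y _ _ hx hy
    rw [inner_add_left, hx, hy, add_zero]
  · intro a x _ hx
    rw [inner_smul_left, hx, mul_zero]

lemma ModelSpace.exists_sub_mem_partialSum {J K : Set ℕ} {r : ℕ} (hJ : J ⊆ insert r K)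
    (hr : r ∉ K) {v : 𝓗} (hv : v ∈ S.partialSum J) :
    ∃ q ∈ S.partialSum K, v = q + ip v (S.e r) • S.e r := by
  have hv' := ModelSpace.partialSum_mono hJ hv
  obtain ⟨u, hu, z, hz, rfl⟩ := Submodule.mem_sup.1 hv'
  rw [Set.image_insert_eq, Submodule.mem_span_insert] at hz
  obtain ⟨a, z, hz, rfl⟩ := hz
  have hq : u + z ∈ S.partialSum K :=
    add_mem (Submodule.mem_sup_left hu) (Submodule.mem_sup_right hz)
  have hsplit : u + (a • S.e r + z) = (u + z) + a • S.e r := by abel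
  refine ⟨u + z, hq, ?_⟩
  have ha : ip (u + (a • S.e r + z)) (S.e r) = a := by
    rw [hsplit, ip, inner_add_right, inner_e_of_mem_partialSum hq hr, inner_smul_right,
      inner_self_eq_norm_sq_to_K, S.orthonormal_e.1]
    simp
  rw [ha, hsplit]

/-- In the normal form of the modified algorithm, where `e r` occurs only in connection with a
positive diagonal coefficient, a sequence is determined by its Gram matrix and its scalar products
with the vectors `h_{m,n}`. -/
theorem eq_of_gram_eq {f f' : ℕ → 𝓗}
    (hf : ∀ r, f r ∈ S.partialSum {j | 0 < ip (f j) (S.e j) ∧ j ≤ r} ∧ 0 ≤ ip (f r) (S.e r))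
    (hf' : ∀ r, f' r ∈ S.partialSum {j | 0 < ip (f' j) (S.e j) ∧ j ≤ r} ∧
      0 ≤ ip (f' r) (S.e r))
    (hh : ∀ r m n, inner ℂ (S.h m n) (f r) = inner ℂ (S.h m n) (f' r))
    (hff : ∀ r q, inner ℂ (f r) (f q) = inner ℂ (f' r) (f' q)) : f = f' := by
  funext r
  induction r using Nat.strong_induction_on with
  | _ r ih =>
    set K : ℕ → Set ℕ := fun k => {j | 0 < ip (f j) (S.e j) ∧ j < k} with hK
    have hKr : ∀ k, k ∉ K k := fun k h => lt_irrefl _ h.2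
    have hsplit : ∀ k, ∃ q ∈ S.partialSum (K k), f k = q + ip (f k) (S.e k) • S.e k := fun k =>
      ModelSpace.exists_sub_mem_partialSum (K := K k)
        (fun j hj => hj.2.eq_or_lt.imp (fun h => h) fun h => And.intro hj.1 h) (hKr k) (hf k).1
    obtain ⟨q, hq, hfq⟩ := hsplit r
    obtain ⟨q', hq', hfq'⟩ : ∃ q ∈ S.partialSum (K r), f' r = q + ip (f' r) (S.e r) • S.e r := by
      refine ModelSpace.exists_sub_mem_partialSum (K := K r)
        (fun j hj => hj.2.eq_or_lt.imp (fun h => h) fun h => And.intro ?_ h) (hKr r) (hf' r).1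
      rw [ih j h]
      exact hj.1
    have hhe : ∀ m n, inner ℂ (S.h m n) (S.e r) = 0 := fun m n => by
      rw [← inner_conj_symm, S.inner_e_of_mem_H0 (S.h_mem m n), map_zero]
    have hfe : ∀ j < r, inner ℂ (f j) (S.e r) = 0 := fun j hj =>
      ModelSpace.inner_e_of_mem_partialSum' (hf j).1 fun h => absurd h.2 (not_le.2 hj)
    have hvh : ∀ m n, inner ℂ (S.h m n) (q - q') = 0 := by
      intro m n
      have h := hh r m n
      rw [hfq, hfq', inner_add_right, inner_add_right, inner_smul_right, inner_smul_right, hhe,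
        mul_zero, mul_zero, add_zero, add_zero] at h
      rw [inner_sub_right, h, sub_self]
    have hvf : ∀ j < r, inner ℂ (f j) (q - q') = 0 := by
      intro j hj
      have h := hff j r
      rw [← ih j hj, hfq, hfq', inner_add_right, inner_add_right, inner_smul_right,
        inner_smul_right, hfe j hj, mul_zero, mul_zero, add_zero, add_zero] at h
      rw [inner_sub_right, h, sub_self]
    -- `e j` is a combination of `f j` and of vectors which are already known to be orthogonal
    have hve : ∀ j, j ∈ K r → inner ℂ (S.e j) (q - q') = 0 := by
      intro j
      induction j using Nat.strong_induction_on with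
      | _ j ihj =>
        intro hj
        obtain ⟨u, hu, hfu⟩ := hsplit j
        have h1 : inner ℂ u (q - q') = 0 :=
          ModelSpace.inner_eq_zero_of_mem_partialSum hvh
            (fun i hi => ihj i hi.2 ⟨hi.1, hi.2.trans hj.2⟩) hu
        have h2 := hvf j hj.2
        rw [hfu, inner_add_left, h1, zero_add, inner_smul_left] at h2
        exact (mul_eq_zero.1 h2).resolve_left (by simpa using hj.1.ne')
    have hqq : q = q' := by
      rw [← sub_eq_zero, ← inner_self_eq_zero (𝕜 := ℂ)]
      exact ModelSpace.inner_eq_zero_of_mem_partialSum hvh hve (sub_mem hq hq')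
    -- only the coefficients at `e r` are left, and they are determined by the norms of the vectors
    have hnorm : ∀ c : ℂ, inner ℂ (q + c • S.e r) (q + c • S.e r) =
        inner ℂ q q + (‖c‖ : ℂ) ^ 2 := by
      intro c
      rw [inner_add_left, inner_add_right, inner_add_right, inner_smul_right, inner_smul_left,
        ModelSpace.inner_e_of_mem_partialSum hq (hKr r), inner_smul_left, inner_smul_right,
        ModelSpace.inner_e_of_mem_partialSum' hq (hKr r), inner_self_eq_norm_sq_to_K (S.e r),
        S.orthonormal_e.1, ← Complex.conj_mul']
      simp
    have hc : ip (f r) (S.e r) = ip (f' r) (S.e r) := by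
      have h := hff r r
      rw [hfq, hfq', ← hqq, hnorm, hnorm, add_left_cancel_iff] at h
      have h1 : ‖ip (f r) (S.e r)‖ = ‖ip (f' r) (S.e r)‖ :=
        (sq_eq_sq₀ (norm_nonneg _) (norm_nonneg _)).1 (by exact_mod_cast h)
      rw [← Complex.norm_of_nonneg' (hf r).2, h1, Complex.norm_of_nonneg' (hf' r).2]
    rw [hfq, hfq', hqq, hc]

/-- Every solution `μ` of the moment problem is represented in the model space: the vectors
`y_{w(r)}` of `L²(μ)` have a triangular copy. -/
theorem Solves.exists_triangular [CompleteSpace 𝓗] {μ : Measure (ℝ × ℝ)} (hμ : Solves s μ)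
    (S : ModelSpace s 𝓗) (w : ℕ ≃ Idx.Omega') :
    ∃ (f p : ℕ → 𝓗) (β : ℕ → ℕ → ℂ), (∀ r, p r ∈ S.H0) ∧
      (∀ r, f r = p r + ∑ j ∈ Finset.range (r + 1), β r j • S.e j) ∧
      (∀ r, 0 ≤ β r r) ∧ (∀ r j, β j j = 0 → β r j = 0) ∧
      (∀ r, ‖f r‖ ^ 2 = ∫ x, ‖extMonomial (w r) x‖ ^ 2 ∂μ) ∧
      HasGramFunction (assemble S w f) fun a => ∫ x, extMonomial a x ∂μ := by
  set X : Idx → Lp ℂ 2 μ := fun a => (hμ.memLp_extMonomial a).toLp with hX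
  have hXX : ∀ a b, inner ℂ (X b) (X a) = ∫ x, extMonomial (a.mulConj b) x ∂μ := hμ.inner_toLp
  have hhX : ∀ m n m' n', inner ℂ (S.h m n) (S.h m' n') =
      inner ℂ (X ⟨m, 0, 0, n, 0, 0⟩) (X ⟨m', 0, 0, n', 0, 0⟩) := by
    intro m n m' n'
    have h1 := S.gram m' n' m n
    rw [ip] at h1
    rw [h1, hXX, ← (hμ _ _).2]
    simp only [Idx.mulConj, add_zero, extMonomial_omega0]
  have hspan : (Submodule.span ℂ (Set.range fun p : ℕ × ℕ => S.h p.1 p.2)).topologicalClosure =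
    S.H0 := S.span_h
  obtain ⟨f, p, β, hp, hf, hβ, hβ0, hfh, hff⟩ := exists_triangular_copy
    (x := fun i : ℕ × ℕ => X ⟨i.1, 0, 0, i.2, 0, 0⟩) (h := fun i : ℕ × ℕ => S.h i.1 i.2)
    (fun i j => hhX _ _ _ _) (fun r => X (w r)) S.orthonormal_e
    (fun u hu j => S.inner_e_of_mem_H0 (hspan ▸ hu) j)
  have hgram : ∀ a b, inner ℂ (assemble S w f b) (assemble S w f a) = inner ℂ (X b) (X a) := by
    intro a b
    rcases mem_omega0_or_eq_w w a with ha | ⟨i, rfl⟩ <;>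
      rcases mem_omega0_or_eq_w w b with hb | ⟨j, rfl⟩
    · rw [assemble_of_mem_omega0 _ ha, assemble_of_mem_omega0 _ hb, hhX, ← eq_omega0_idx ha,
        ← eq_omega0_idx hb]
    · rw [assemble_of_mem_omega0 _ ha, assemble_w, hfh j (a.m, a.n), ← eq_omega0_idx ha]
    · rw [assemble_of_mem_omega0 _ hb, assemble_w, ← inner_conj_symm, hfh i (b.m, b.n),
        ← eq_omega0_idx hb, inner_conj_symm]
    · rw [assemble_w, assemble_w, hff]
  refine ⟨f, p, β, fun r => hspan ▸ hp r, hf, hβ, hβ0, fun r => ?_, fun a b => ?_⟩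
  · have h1 := hff r r
    rw [hXX, inner_self_eq_norm_sq_to_K] at h1
    have h2 : ∀ x, extMonomial ((w r : Idx).mulConj (w r)) x =
        ((‖extMonomial (w r) x‖ ^ 2 : ℝ) : ℂ) := fun x => by
      rw [extMonomial_mulConj, Complex.mul_conj, Complex.normSq_eq_norm_sq]
    simp_rw [h2] at h1
    rw [integral_complex_ofReal] at h1
    exact Complex.ofReal_injective ((Complex.ofReal_pow _ _).trans h1)
  · exact (hgram a b).trans (hXX a b)

lemma Generates.solves {f : ℕ → 𝓗} {μ : Measure (ℝ × ℝ)}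
    (h : Generates (assemble S w f) μ) : Solves s μ := by
  obtain ⟨φ, hφ, hμ⟩ := h
  intro m n
  have hmem : ∀ m n : ℕ, (⟨m, 0, 0, n, 0, 0⟩ : Idx) ∈ Idx.Omega0 := fun _ _ => ⟨rfl, rfl, rfl, rfl⟩
  have h1 := hμ ⟨m, 0, 0, n, 0, 0⟩
  have h2 : φ ⟨m, 0, 0, n, 0, 0⟩ = s m n := by
    rw [hφ.apply_eq, assemble_of_mem_omega0 _ (hmem m n), assemble_of_mem_omega0 _ (hmem 0 0),
      S.gram, add_zero, add_zero]
  rw [h2] at h1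
  simpa only [funext (extMonomial_omega0 m n)] using h1

variable {ι : Type*} {g : HilbertBasis ι ℂ S.H0} {M : ℕ → ℝ} {f : ℕ → 𝓗}

lemma shiftRelations_of_isStepOutput (h : ∀ r, ∃ A, IsStepOutput S w g M f r A) :
    ShiftRelations (assemble S w f) :=
  shiftRelations_of_linearConditions (linearConditions_of_isStepOutput h)

lemma exists_hasGramFunction_of_isStepOutput (h : ∀ r, ∃ A, IsStepOutput S w g M f r A) :
    ∃ φ, HasGramFunction (assemble S w f) φ :=
  ⟨_, hasGramFunction_of_linearConditions (linearConditions_of_isStepOutput h)⟩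

lemma existsUnique_generates_of_isStepOutput (h : ∀ r, ∃ A, IsStepOutput S w g M f r A) :
    ∃! μ, Generates (assemble S w f) μ :=
  let ⟨_, hφ⟩ := exists_hasGramFunction_of_isStepOutput h
  existsUnique_generates (shiftRelations_of_isStepOutput h) hφ

lemma assemble_omega0 (f : ℕ → 𝓗) (m n : ℕ) :
    assemble S w f ⟨m, 0, 0, n, 0, 0⟩ = S.h m n :=
  assemble_of_mem_omega0 f (a := ⟨m, 0, 0, n, 0, 0⟩) ⟨rfl, rfl, rfl, rfl⟩

lemma assemble_mem_setX (h : f ∈ setG S w g M) : assemble S w f ∈ setX S w := by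
  have hstep := mem_setG_iff.1 h
  have hex : ∀ r, ∃ A, IsStepOutput S w g M f r A := fun r => ⟨_, hstep r⟩
  refine ⟨assemble_omega0 f, ⟨Set.univ, fun r => ?_⟩, shiftRelations_of_isStepOutput hex,
    exists_hasGramFunction_of_isStepOutput hex⟩
  rw [assemble_w]
  exact ⟨(hstep r).mem_of_subset (fun _ _ => trivial) fun _ => trivial, (hstep r).ip_nonneg⟩

lemma exists_isStepOutput_of_mem_setGmod (h : f ∈ setGmod S w g M) (r : ℕ) :
    ∃ A, IsStepOutput S w g M f r A :=
  let ⟨_, _, h2⟩ := mem_setGmod_iff.1 h r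
  ⟨_, h2⟩

lemma mem_partialSum_of_mem_setGmod (h : f ∈ setGmod S w g M) (r : ℕ) :
    f r ∈ S.partialSum {j | 0 < ip (f j) (S.e j) ∧ j ≤ r} ∧ 0 ≤ ip (f r) (S.e r) := by
  obtain ⟨σ, h1, h2⟩ := mem_setGmod_iff.1 h r
  refine ⟨h2.mem_of_subset (Λ := {j | 0 < ip (f j) (S.e j)}) (fun j hj => ?_) fun hr => hr,
    h2.ip_nonneg⟩
  exact ((h1 j).2 (Finset.mem_filter.1 hj).2).2

lemma assemble_mem_setXmod (h : f ∈ setGmod S w g M) : assemble S w f ∈ setXmod S w := by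
  have hex := exists_isStepOutput_of_mem_setGmod h
  refine ⟨assemble_omega0 f, fun r => ?_, shiftRelations_of_isStepOutput hex,
    exists_hasGramFunction_of_isStepOutput hex⟩
  simp only [assemble_w]
  exact mem_partialSum_of_mem_setGmod h r

variable {μ : Measure (ℝ × ℝ)}

/-- The modified algorithm does not find the same solution twice. -/
lemma eq_of_generates_of_mem_setGmod {f f' : ℕ → 𝓗} (h : f ∈ setGmod S w g M)
    (h' : f' ∈ setGmod S w g M) (hμ : Generates (assemble S w f) μ)
    (hμ' : Generates (assemble S w f') μ) : f = f' := by
  obtain ⟨φ, hφ, hs⟩ := hμ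
  obtain ⟨φ', hφ', hs'⟩ := hμ'
  have hφφ : φ = φ' := funext fun a => by rw [← (hs a).2, ← (hs' a).2]
  subst hφφ
  have hgram : ∀ a b, inner ℂ (assemble S w f b) (assemble S w f a) =
      inner ℂ (assemble S w f' b) (assemble S w f' a) := fun a b =>
    (hφ a b).trans (hφ' a b).symm
  refine eq_of_gram_eq (mem_partialSum_of_mem_setGmod h) (mem_partialSum_of_mem_setGmod h')
    (fun r m n => ?_) fun r q => ?_
  · have := hgram (w r) ⟨m, 0, 0, n, 0, 0⟩
    rwa [assemble_w, assemble_w, assemble_omega0, assemble_omega0] at this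
  · have := hgram (w q) (w r)
    rwa [assemble_w, assemble_w, assemble_w, assemble_w] at this

/-- Every solution is found by both algorithms, with the same sequence. -/
lemma Solves.exists_mem_setG [CompleteSpace 𝓗] (hμ : Solves s μ) (hM : IsMomentBound s w M)
    (g : HilbertBasis ι ℂ S.H0) :
    ∃ f, f ∈ setG S w g M ∧ f ∈ setGmod S w g M ∧ Generates (assemble S w f) μ := by
  obtain ⟨f, p, β, hp, hf, hβ, hβ0, hnorm, hgram⟩ := hμ.exists_triangular S w
  have hlin := hgram.linearConditions hμ.solvesExt.scalarShiftRelations fun _ => True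
  have hM' : ∀ r, ‖f r‖ ^ 2 ≤ M r := fun r => (hnorm r).trans_le (hM μ hμ r)
  have hip : ∀ j, ip (f j) (S.e j) = β j j := by
    intro j
    rw [ip, hf, inner_add_right, S.inner_e_of_mem_H0 (hp j), zero_add, inner_sum,
      Finset.sum_eq_single j]
    · rw [inner_smul_right, inner_self_eq_norm_sq_to_K, S.orthonormal_e.1]; simp
    · intro i _ hij
      rw [inner_smul_right, S.orthonormal_e.2 hij.symm, mul_zero]
    · intro h; simp at h
  have hmem : ∀ j, ∀ K : Set ℕ, (∀ i ≤ j, β j i ≠ 0 → i ∈ K) → f j ∈ S.partialSum K := by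
    intro j K hK
    rw [hf]
    refine add_mem (ModelSpace.H0_le_partialSum _ (hp j)) (Submodule.sum_mem _ fun i hi => ?_)
    by_cases h0 : β j i = 0
    · rw [h0, zero_smul]; exact zero_mem _
    · exact Submodule.smul_mem _ _ (ModelSpace.e_mem_partialSum
        (hK i (Nat.lt_succ_iff.1 (Finset.mem_range.1 hi)) h0))
  refine ⟨f, mem_setG_iff.2 fun r => isStepOutput_of_triangular hp hf hβ hlin hM' fun j hj =>
    absurd (Finset.mem_univ j) hj, mem_setGmod_iff.2 fun r => ?_, _, hgram, hμ.solvesExt⟩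
  classical
  refine ⟨fun j => decide (β j j ≠ 0), fun j => ⟨fun hj => ?_, fun hj => ?_⟩,
    isStepOutput_of_triangular hp hf hβ hlin hM' fun j hj => hβ0 r j ?_⟩
  · have h0 : β j j = 0 := by simpa using hj
    refine hmem j _ fun i hi hne => lt_of_le_of_ne hi ?_
    rintro rfl
    exact hne h0
  · have h0 : β j j ≠ 0 := by simpa using hj
    refine ⟨hmem j _ fun i hi _ => hi, ?_⟩
    rw [hip]
    exact lt_of_le_of_ne (hβ j) h0.symm
  · simpa using hj

end Correspondence

end TwoDimMoment

theorem theorem3p3 {𝓗 : Type*} [NormedAddCommGroup 𝓗] [InnerProductSpace ℂ 𝓗] [CompleteSpace 𝓗]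
    (s : ℕ → ℕ → ℂ) (hs : TwoDimMoment.PositivityCondition s)
    (S : TwoDimMoment.ModelSpace s 𝓗)
    (w : ℕ ≃ TwoDimMoment.Idx.Omega')
    {ι : Type*} (b : HilbertBasis ι ℂ S.H0) :
    -- bounds as used by the algorithm exist, and any of them may be used
    (∃ M : ℕ → ℝ, TwoDimMoment.IsMomentBound s w M) ∧
    ∀ M : ℕ → ℝ, TwoDimMoment.IsMomentBound s w M →
      -- the original algorithm
      (((∃ μ, TwoDimMoment.Solves s μ) ↔
          TwoDimMoment.InitialCheck S ∧ (TwoDimMoment.setG S w b M).Nonempty) ∧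
        (∀ g ∈ TwoDimMoment.setG S w b M,
          TwoDimMoment.assemble S w g ∈ TwoDimMoment.setX S w ∧
          (∃! μ, TwoDimMoment.Generates (TwoDimMoment.assemble S w g) μ) ∧
          ∀ μ, TwoDimMoment.Generates (TwoDimMoment.assemble S w g) μ →
            TwoDimMoment.Solves s μ) ∧
        (∀ μ, TwoDimMoment.Solves s μ →
          ∃ g ∈ TwoDimMoment.setG S w b M,
            TwoDimMoment.Generates (TwoDimMoment.assemble S w g) μ)) ∧
      -- the modified algorithm, with a bijective correspondence
      (((∃ μ, TwoDimMoment.Solves s μ) ↔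
          TwoDimMoment.InitialCheck S ∧ (TwoDimMoment.setGmod S w b M).Nonempty) ∧
        (∀ g ∈ TwoDimMoment.setGmod S w b M,
          TwoDimMoment.assemble S w g ∈ TwoDimMoment.setXmod S w ∧
          (∃! μ, TwoDimMoment.Generates (TwoDimMoment.assemble S w g) μ) ∧
          ∀ μ, TwoDimMoment.Generates (TwoDimMoment.assemble S w g) μ →
            TwoDimMoment.Solves s μ) ∧
        (∀ μ, TwoDimMoment.Solves s μ →
          ∃! g, g ∈ TwoDimMoment.setGmod S w b M ∧
            TwoDimMoment.Generates (TwoDimMoment.assemble S w g) μ)) := by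
  open TwoDimMoment in
  refine ⟨exists_isMomentBound s w, fun M hM => ⟨⟨⟨?_, ?_⟩, fun g hg => ?_, fun μ hμ => ?_⟩,
    ⟨?_, ?_⟩, fun g hg => ?_, fun μ hμ => ?_⟩⟩
  · rintro ⟨μ, hμ⟩
    obtain ⟨f, hf, -, -⟩ := hμ.exists_mem_setG hM b
    exact ⟨initialCheck S, f, hf⟩
  · rintro ⟨-, f, hf⟩
    have hstep := mem_setG_iff.1 hf
    obtain ⟨μ, hμ, -⟩ := existsUnique_generates_of_isStepOutput fun r => ⟨_, hstep r⟩
    exact ⟨μ, hμ.solves⟩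
  · have hstep := mem_setG_iff.1 hg
    exact ⟨assemble_mem_setX hg, existsUnique_generates_of_isStepOutput fun r => ⟨_, hstep r⟩,
      fun μ hμ => hμ.solves⟩
  · obtain ⟨f, hf, -, hgen⟩ := hμ.exists_mem_setG hM b
    exact ⟨f, hf, hgen⟩
  · rintro ⟨μ, hμ⟩
    obtain ⟨f, -, hf, -⟩ := hμ.exists_mem_setG hM b
    exact ⟨initialCheck S, f, hf⟩
  · rintro ⟨-, f, hf⟩
    obtain ⟨μ, hμ, -⟩ :=
      existsUnique_generates_of_isStepOutput (exists_isStepOutput_of_mem_setGmod hf)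
    exact ⟨μ, hμ.solves⟩
  · exact ⟨assemble_mem_setXmod hg,
      existsUnique_generates_of_isStepOutput (exists_isStepOutput_of_mem_setGmod hg),
      fun μ hμ => hμ.solves⟩
  · obtain ⟨f, -, hf, hgen⟩ := hμ.exists_mem_setG hM b
    exact ⟨f, ⟨hf, hgen⟩, fun f' hf' => eq_of_generates_of_mem_setGmod hf'.1 hf hf'.2 hgen⟩
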